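/- Let $X, X_1,X_2,\dots$ be independent and identically distributed $\mathbb{Z}$-valued random variables on a probability space, let $S_0=0$ and $S_n=X_1+\cdots+X_n$, and let $\phi(\theta)=E e^{i\theta X}$. Let $1<\alpha<2$ and suppose that the walk $S_n$ is in the domain of normal attraction of a strictly stable law of index $\alpha$, in the sense that $$\lim_{\theta\to\pm0}\frac{1-\phi(\theta)}{|\theta|^{\alpha}}=c_\circ e^{\pm i\pi\gamma/2}$$ for some real numbers $c_\circ>0$ and $\gamma$ with $|\gamma|\le 2-\alpha$. Suppose also that the walk is strongly aperiodic: for every $x\in\mathbb{Z}$, $P[S_n=x]>0$ for all sufficiently large $n$ (in particular, the walk is irreducible). Let $$f^0(n)=P\big[\inf\{k\ge1: S_k=0\}=n\big]$$ be the probability that the walk returns to the origin for the first time at time $n$, and put $$\kappa_{\alpha,\gamma}=\frac{(\alpha-1)\sin\frac{\pi}{\alpha}}{\Gamma\big(\frac1\alpha\big)\,\sin\frac{\pi(\alpha-\gamma)}{2\alpha}}.$$ Then, as $n\to\infty$, $$f^0(n)\sim\frac{\kappa_{\alpha,\gamma}\,c_\circ^{1/\alpha}}{n^{2-1/\alpha}},$$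 that is, the ratio of the two sides tends to $1$. -/

import Mathlib

open MeasureTheory ProbabilityTheory Filter Topology Asymptotics

noncomputable section

/-- The random walk started at `x` with increments `X 0, X 1, …`. -/
def walk {Ω : Type*} (X : ℕ → Ω → ℤ) (x : ℤ) (n : ℕ) (ω : Ω) : ℤ :=
  x + ∑ i ∈ Finset.range n, X i ω

/-- The time of the first entrance into `B` at a time `n ≥ 1` of the walk started at `x`
(`⊤` if there is none). -/
def entranceTime {Ω : Type*} (X : ℕ → Ω → ℤ) (x : ℤ) (B : Set ℤ) (ω : Ω) : ℕ∞ :=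
  ⨅ (n : ℕ) (_ : 1 ≤ n ∧ walk X x n ω ∈ B), (n : ℕ∞)

/-- The probability that the walk started at `x` visits the origin at time `n` for the first
time after time `0`. -/
def firstHitProb {Ω : Type*} [MeasurableSpace Ω] (μ : Measure Ω) (X : ℕ → Ω → ℤ)
    (x : ℤ) (n : ℕ) : ℝ :=
  μ.real {ω | entranceTime X x {0} ω = (n : ℕ∞)}

/-- The increments are measurable, independent and identically distributed. -/
structure IsIIDIncrements {Ω : Type*} [MeasurableSpace Ω] (μ : Measure Ω)
    (X : ℕ → Ω → ℤ) : Prop where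
  measurable : ∀ i, Measurable (X i)
  indep : iIndepFun X μ
  identDistrib : ∀ i, IdentDistrib (X i) (X 0) μ μ

/-- Strong aperiodicity: each site is charged by the walk started at `0` at every sufficiently
large time. -/
def IsStronglyAperiodic {Ω : Type*} [MeasurableSpace Ω] (μ : Measure Ω)
    (X : ℕ → Ω → ℤ) : Prop :=
  ∀ x : ℤ, ∀ᶠ n in atTop, 0 < μ.real {ω | walk X 0 n ω = x}

/-- The characteristic function `θ ↦ E exp(i θ ξ)` of an integer-valued random variable `ξ`. -/
def intCharFun {Ω : Type*} [MeasurableSpace Ω] (μ : Measure Ω) (ξ : Ω → ℤ) (θ : ℝ) : ℂ :=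
  charFun (μ.map (fun ω => (ξ ω : ℝ))) θ

/-- The law of `ξ` belongs to the domain of normal attraction of the strictly stable law with
characteristic function `exp(-c |θ| ^ α exp(i (sgn θ) π γ / 2))`, expressed by the behaviour of
its characteristic function at the origin. -/
structure InDomainOfNormalAttraction {Ω : Type*} [MeasurableSpace Ω] (μ : Measure Ω)
    (ξ : Ω → ℤ) (α γ c : ℝ) : Prop where
  right : Tendsto (fun θ : ℝ => (1 - intCharFun μ ξ θ) / ((|θ| ^ α : ℝ) : ℂ)) (𝓝[>] 0)
    (𝓝 ((c : ℂ) * Complex.exp (Complex.I * Real.pi * γ / 2)))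
  left : Tendsto (fun θ : ℝ => (1 - intCharFun μ ξ θ) / ((|θ| ^ α : ℝ) : ℂ)) (𝓝[<] 0)
    (𝓝 ((c : ℂ) * Complex.exp (-(Complex.I * Real.pi * γ / 2))))

/-- The constant `κ_{α,γ}`. -/
def returnConst (α γ : ℝ) : ℝ :=
  (α - 1) * Real.sin (Real.pi / α) /
    (Real.Gamma (1 / α) * Real.sin (Real.pi * (α - γ) / (2 * α)))

end

/-! Write `F` and `U` for the generating functions of the first-return probabilities and of `P[S_n =
0]`. The renewal equation gives `F = 1 - 1/U` in the open unit disc, and Fourier inversion gives `2π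
U(s) = R₀(s)`, where `R_k(s) = ∫ φ^k / (1 - sφ)^(k+1)` over a period. The `R_k` are the Taylor
derivatives of `R₀` (`R₀' = R₁`, `R₁' = 2 R₂`), so `F''` is an explicit rational expression in `R₀,
R₁, R₂`.

As `s → 1` in the disc, without restriction on the direction, the substitution `θ = |1-s|^(1/α) x`
compares `R_k` with the same integral for the symbol `1 - φ = a|θ|^α` on the whole line
(`tendsto_scaled_resolventMoment_sub`). Gamma integrals evaluate the latter exactly, whence `R_k(s)
~ M_k (1-s)^(-(k+1-1/α))`. The uniform input is the lower bound `|1 - sφ(θ)| ≥ c (|1-s| + |θ|^α)` of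
`exists_le_norm_one_sub_mul`, in which strong aperiodicity excludes any other singularity on the
unit circle.

Hence `F''(s) ~ C (1-s)^(-p)` with `p = 1 + 1/α`, and `F''` is bounded away from `s = 1`. The
transfer `tendsto_coeff_of_singularity` needs no continuation beyond the disc: after subtraction of
`C (1-s)^(-p)`, Cauchy's formula on the circle of radius `1 - 1/n` shows that the remainder has
coefficients `o(n^(p-1))`. This works exactly because `p > 1`, which is why `F` is differentiated
twice: `F'` would only have exponent `1/α < 1`. Dividing by `(n+2)(n+1)` recovers the coefficients
of `F`, and Euler's reflection formula puts the constant in the stated form. -/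

/-! ### Gamma integrals with complex parameters -/

theorem integrableOn_rpow_mul_exp_neg_mul {a b : ℝ} (ha : 0 < a) (hb : 0 < b) :
    IntegrableOn (fun t : ℝ => t ^ (a - 1) * Real.exp (-(b * t))) (Set.Ioi 0) := by
  simpa [neg_mul] using
    integrableOn_rpow_mul_exp_neg_mul_rpow (p := 1) (s := a - 1) (b := b) (by linarith) one_pos hb

theorem norm_rpow_mul_cexp_neg_mul {a t : ℝ} (ht : 0 < t) (r : ℂ) :
    ‖((t ^ a : ℝ) : ℂ) * Complex.exp (-(r * t))‖ = t ^ a * Real.exp (-(r.re * t)) := by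
  rw [norm_mul, Complex.norm_exp, Complex.norm_real, Real.norm_of_nonneg (by positivity)]
  simp

theorem continuousOn_rpow_mul_cexp_neg_mul (a : ℝ) (r : ℂ) :
    ContinuousOn (fun t : ℝ => ((t ^ a : ℝ) : ℂ) * Complex.exp (-(r * t))) (Set.Ioi 0) := by
  refine ContinuousOn.mul ?_ (by fun_prop)
  refine Complex.continuous_ofReal.comp_continuousOn fun t ht => ?_
  exact (Real.continuousAt_rpow_const t a (Or.inl (ne_of_gt ht))).continuousWithinAt

theorem integrableOn_rpow_mul_cexp_neg_mul {a : ℝ} (ha : 0 < a) {r : ℂ} (hr : 0 < r.re) :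
    IntegrableOn (fun t : ℝ => ((t ^ (a - 1) : ℝ) : ℂ) * Complex.exp (-(r * t)))
      (Set.Ioi 0) := by
  refine (integrableOn_rpow_mul_exp_neg_mul ha hr).mono'
    ((continuousOn_rpow_mul_cexp_neg_mul _ r).aestronglyMeasurable measurableSet_Ioi) ?_
  filter_upwards [ae_restrict_mem measurableSet_Ioi] with t ht
  exact (norm_rpow_mul_cexp_neg_mul ht r).le

theorem hasDerivAt_integral_rpow_mul_cexp_neg_mul {a : ℝ} (ha : 0 < a) {r : ℂ} (hr : 0 < r.re) :
    HasDerivAt (fun r : ℂ => ∫ t in Set.Ioi (0 : ℝ), ((t ^ (a - 1) : ℝ) : ℂ) *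
      Complex.exp (-(r * t)))
      (∫ t in Set.Ioi (0 : ℝ), -(((t ^ (a + 1 - 1) : ℝ) : ℂ) * Complex.exp (-(r * t)))) r := by
  -- On this half-plane all the `t`-derivatives are dominated by one integrable function.
  have hs : {z : ℂ | r.re / 2 < z.re} ∈ 𝓝 r :=
    (isOpen_lt continuous_const Complex.continuous_re).mem_nhds (by simp; linarith)
  refine (hasDerivAt_integral_of_dominated_loc_of_deriv_le (𝕜 := ℂ) hs
    (F := fun z t => ((t ^ (a - 1) : ℝ) : ℂ) * Complex.exp (-(z * t)))
    (F' := fun z t => -(((t ^ (a + 1 - 1) : ℝ) : ℂ) * Complex.exp (-(z * t))))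
    (bound := fun t => t ^ (a + 1 - 1) * Real.exp (-(r.re / 2 * t))) ?_
    (integrableOn_rpow_mul_cexp_neg_mul ha hr) ?_ ?_
    (integrableOn_rpow_mul_exp_neg_mul (by linarith) (by linarith)) ?_).2
  · exact Eventually.of_forall fun z =>
      (continuousOn_rpow_mul_cexp_neg_mul _ z).aestronglyMeasurable measurableSet_Ioi
  · exact ((continuousOn_rpow_mul_cexp_neg_mul _ r).aestronglyMeasurable measurableSet_Ioi).neg
  · filter_upwards [ae_restrict_mem measurableSet_Ioi] with t ht z hz
    rw [norm_neg, norm_rpow_mul_cexp_neg_mul ht]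
    have ht' : (0 : ℝ) < t := ht
    have hz' : r.re / 2 < z.re := hz
    gcongr
  · filter_upwards [ae_restrict_mem measurableSet_Ioi] with t ht z hz
    have ht' : (0 : ℝ) < t := ht
    have h1 : HasDerivAt (fun z : ℂ => -(z * t)) (-(1 * (t : ℂ))) z :=
      ((hasDerivAt_id z).mul_const _).neg
    refine (h1.cexp.const_mul ((t ^ (a - 1) : ℝ) : ℂ)).congr_deriv ?_
    rw [show a + 1 - 1 = (a - 1) + 1 by ring, Real.rpow_add_one ht'.ne']
    push_cast
    ring

/-- The Gamma integral with a complex scale parameter. -/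
theorem integral_rpow_mul_cexp_neg_mul {a : ℝ} (ha : 0 < a) {r : ℂ} (hr : 0 < r.re) :
    ∫ t in Set.Ioi (0 : ℝ), ((t ^ (a - 1) : ℝ) : ℂ) * Complex.exp (-(r * t)) =
      r ^ (-(a : ℂ)) * Complex.Gamma a := by
  have hU : IsOpen {z : ℂ | 0 < z.re} := isOpen_lt continuous_const Complex.continuous_re
  have hF : AnalyticOnNhd ℂ (fun r : ℂ => ∫ t in Set.Ioi (0 : ℝ), ((t ^ (a - 1) : ℝ) : ℂ) *
      Complex.exp (-(r * t))) {z : ℂ | 0 < z.re} :=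
    DifferentiableOn.analyticOnNhd (fun z hz =>
      (hasDerivAt_integral_rpow_mul_cexp_neg_mul ha hz).differentiableAt.differentiableWithinAt) hU
  have hG : AnalyticOnNhd ℂ (fun r : ℂ => r ^ (-(a : ℂ)) * Complex.Gamma a)
      {z : ℂ | 0 < z.re} := by
    refine DifferentiableOn.analyticOnNhd (fun z hz => ?_) hU
    have : z ∈ Complex.slitPlane := Or.inl hz
    exact ((differentiableAt_id.cpow_const this).mul_const _).differentiableWithinAt
  -- Identity theorem: both sides are holomorphic in the right half-plane, and for real positive `r`
  -- this is the classical Gamma integral.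
  refine hF.eqOn_of_preconnected_of_frequently_eq hG
    (convex_halfSpace_re_gt 0).isPreconnected (z₀ := 1) (by simp) ?_ hr
  have ht : Tendsto (fun x : ℝ => (x : ℂ)) (𝓝[≠] 1) (𝓝[≠] 1) := by
    refine tendsto_nhdsWithin_iff.2 ⟨?_, ?_⟩
    · exact (Complex.continuous_ofReal.tendsto' 1 1 (by simp)).mono_left nhdsWithin_le_nhds
    · filter_upwards [self_mem_nhdsWithin] with x hx
      simpa using hx
  refine ht.frequently (Eventually.frequently ?_)
  filter_upwards [nhdsWithin_le_nhds (lt_mem_nhds (show (0 : ℝ) < 1 by norm_num))] with x hx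
  have := Complex.integral_cpow_mul_exp_neg_mul_Ioi (a := a) (by simpa using ha) hx
  have harg : Complex.arg x ≠ Real.pi := by
    rw [Complex.arg_ofReal_of_nonneg hx.le]; exact Real.pi_pos.ne
  rw [one_div, Complex.inv_cpow _ _ harg, ← Complex.cpow_neg] at this
  rw [← this]
  refine setIntegral_congr_fun measurableSet_Ioi fun t ht => ?_
  have ht' : (0 : ℝ) < t := ht
  rw [Complex.ofReal_cpow ht'.le]
  push_cast
  rfl

/-- The integral of a stretched exponential with a complex scale parameter. -/
theorem integral_cexp_neg_mul_rpow {α : ℝ} (hα : 0 < α) {b : ℂ} (hb : 0 < b.re) :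
    ∫ x in Set.Ioi (0 : ℝ), Complex.exp (-(b * ((x ^ α : ℝ) : ℂ))) =
      b ^ (-((1 / α : ℝ) : ℂ)) * Complex.Gamma ((1 / α + 1 : ℝ) : ℂ) := by
  have hβ : 0 < 1 / α := by positivity
  rw [← integral_comp_rpow_Ioi_of_pos (p := 1 / α) hβ]
  have : ∀ x ∈ Set.Ioi (0 : ℝ), ((1 / α) * x ^ (1 / α - 1)) •
      Complex.exp (-(b * (((x ^ (1 / α)) ^ α : ℝ) : ℂ))) =
      ((1 / α : ℝ) : ℂ) * (((x ^ (1 / α - 1) : ℝ) : ℂ) * Complex.exp (-(b * x))) := by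
    intro x hx
    rw [← Real.rpow_mul (le_of_lt hx), one_div_mul_cancel hα.ne', Real.rpow_one,
      Complex.real_smul]
    push_cast
    ring
  rw [setIntegral_congr_fun measurableSet_Ioi this, integral_const_mul,
    integral_rpow_mul_cexp_neg_mul hβ hb]
  rw [Complex.ofReal_add, Complex.ofReal_one, Complex.Gamma_add_one _ (by exact_mod_cast hβ.ne')]
  ring

/-- Writing a negative power as a Laplace transform makes the dependence on the symbol exponential;
after Fubini the integral over `x` becomes a stretched exponential. -/
theorem inv_pow_eq_integral {z : ℂ} (hz : 0 < z.re) (k : ℕ) :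
    (z ^ (k + 1))⁻¹ = ((k.factorial : ℂ))⁻¹ *
      ∫ t in Set.Ioi (0 : ℝ), ((t ^ (k : ℝ) : ℝ) : ℂ) * Complex.exp (-(z * t)) := by
  have h := integral_rpow_mul_cexp_neg_mul (a := (k : ℝ) + 1) (by positivity) hz
  rw [add_sub_cancel_right] at h
  rw [h]
  push_cast
  rw [Complex.Gamma_nat_eq_factorial, Complex.cpow_neg]
  have : z ^ ((k : ℂ) + 1) = z ^ (k + 1) := by
    rw [← Complex.cpow_natCast]; push_cast; rfl
  rw [this]
  have : (k.factorial : ℂ) ≠ 0 := by exact_mod_cast k.factorial_ne_zero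
  field_simp

/-- Integrating the modulus over `x` first costs a factor `t ^ (-1/α)`, which stays integrable at `t
= 0` even for `k = 0` because `α > 1`. -/
theorem integrable_prod_rpow_mul_cexp {α : ℝ} (hα : 1 < α) {w a : ℂ} (hw : 0 < w.re)
    (ha : 0 < a.re) (k : ℕ) :
    Integrable (Function.uncurry fun (x t : ℝ) => ((t ^ (k : ℝ) : ℝ) : ℂ) *
      Complex.exp (-((w + a * ((x ^ α : ℝ) : ℂ)) * t)))
      ((volume.restrict (Set.Ioi 0)).prod (volume.restrict (Set.Ioi 0))) := by
  have hα0 : 0 < α := by linarith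
  have hβ : 1 / α < 1 := by rw [div_lt_one hα0]; exact hα
  rw [integrable_prod_iff']
  · have hnorm : ∀ x t : ℝ, 0 < t → ‖((t ^ (k : ℝ) : ℝ) : ℂ) *
        Complex.exp (-((w + a * ((x ^ α : ℝ) : ℂ)) * t))‖ =
        t ^ (k : ℝ) * Real.exp (-(w.re * t)) * Real.exp (-(a.re * t) * x ^ α) := by
      intro x t ht
      rw [norm_rpow_mul_cexp_neg_mul ht, mul_assoc, ← Real.exp_add]
      congr 2
      simp
      ring
    constructor
    · filter_upwards [ae_restrict_mem measurableSet_Ioi] with t ht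
      have ht' : (0 : ℝ) < t := ht
      have h1 := (integrableOn_rpow_mul_exp_neg_mul_rpow (s := 0) (by norm_num) hα0
        (mul_pos ha ht')).const_mul (t ^ (k : ℝ) * Real.exp (-(w.re * t)))
      refine h1.mono' ?_ ?_
      · refine Measurable.aestronglyMeasurable ?_
        simp only [Function.uncurry]
        fun_prop
      · filter_upwards with x
        simp only [Function.uncurry]
        rw [hnorm x t ht']
        simp
    · have h2 : ∀ t ∈ Set.Ioi (0 : ℝ), (∫ x in Set.Ioi (0 : ℝ), ‖Function.uncurry
          (fun (x t : ℝ) => ((t ^ (k : ℝ) : ℝ) : ℂ) *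
          Complex.exp (-((w + a * ((x ^ α : ℝ) : ℂ)) * t))) (x, t)‖) =
          (a.re ^ (-1 / α) * Real.Gamma (1 / α + 1)) *
            (t ^ ((k + 1 - 1 / α) - 1) * Real.exp (-(w.re * t))) := by
        intro t ht
        have ht' : (0 : ℝ) < t := ht
        simp only [Function.uncurry]
        simp_rw [hnorm _ t ht']
        rw [integral_const_mul, integral_exp_neg_mul_rpow hα0 (mul_pos ha ht'),
          Real.mul_rpow ha.le ht'.le,
          show (k : ℝ) + 1 - 1 / α - 1 = k + -1 / α by ring, Real.rpow_add ht']
        ring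
      refine IntegrableOn.congr_fun ?_ (fun t ht => (h2 t ht).symm) measurableSet_Ioi
      exact (integrableOn_rpow_mul_exp_neg_mul
        (by have : (0 : ℝ) ≤ k := k.cast_nonneg
            linarith) hw).const_mul _
  · refine Measurable.aestronglyMeasurable ?_
    simp only [Function.uncurry_def]
    fun_prop

theorem mul_ofReal_cpow_of_re_pos {a : ℂ} (ha : 0 < a.re) {t : ℝ} (ht : 0 < t) (s : ℝ) :
    (a * t) ^ (s : ℂ) = a ^ (s : ℂ) * ((t ^ s : ℝ) : ℂ) := by
  have ha0 : a ≠ 0 := fun h => by simp [h] at ha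
  have ht0 : (t : ℂ) ≠ 0 := by exact_mod_cast ht.ne'
  rw [Complex.ofReal_cpow ht.le, mul_comm a, Complex.cpow_def_of_ne_zero (mul_ne_zero ht0 ha0),
    Complex.cpow_def_of_ne_zero ht0, Complex.cpow_def_of_ne_zero ha0, Complex.log_ofReal_mul ht ha0,
    ← Complex.exp_add, Complex.ofReal_log ht.le]
  ring_nf

/-- A power of a resolvent with a fractional power symbol, integrated over a half-line. -/
theorem integral_inv_pow_add_mul_rpow {α : ℝ} (hα : 1 < α) {w a : ℂ} (hw : 0 < w.re)
    (ha : 0 < a.re) (k : ℕ) :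
    ∫ x in Set.Ioi (0 : ℝ), ((w + a * ((x ^ α : ℝ) : ℂ)) ^ (k + 1))⁻¹ =
      (k.factorial : ℂ)⁻¹ * Complex.Gamma ((1 / α + 1 : ℝ) : ℂ) *
        Complex.Gamma ((k + 1 - 1 / α : ℝ) : ℂ) * a ^ (-((1 / α : ℝ) : ℂ)) *
        w ^ (-((k + 1 - 1 / α : ℝ) : ℂ)) := by
  have hα0 : 0 < α := by linarith
  have hβ : 1 / α < 1 := by rw [div_lt_one hα0]; exact hα
  have hk : (0 : ℝ) ≤ k := k.cast_nonneg
  have h1 : ∀ x ∈ Set.Ioi (0 : ℝ), ((w + a * ((x ^ α : ℝ) : ℂ)) ^ (k + 1))⁻¹ =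
      (k.factorial : ℂ)⁻¹ * ∫ t in Set.Ioi (0 : ℝ), ((t ^ (k : ℝ) : ℝ) : ℂ) *
        Complex.exp (-((w + a * ((x ^ α : ℝ) : ℂ)) * t)) := by
    intro x hx
    refine inv_pow_eq_integral ?_ k
    have : 0 ≤ x ^ α := Real.rpow_nonneg (le_of_lt hx) _
    simp
    positivity
  have h2 : ∀ t ∈ Set.Ioi (0 : ℝ), (∫ x in Set.Ioi (0 : ℝ), ((t ^ (k : ℝ) : ℝ) : ℂ) *
        Complex.exp (-((w + a * ((x ^ α : ℝ) : ℂ)) * t))) =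
      (a ^ (-((1 / α : ℝ) : ℂ)) * Complex.Gamma ((1 / α + 1 : ℝ) : ℂ)) *
        (((t ^ ((k + 1 - 1 / α) - 1) : ℝ) : ℂ) * Complex.exp (-(w * t))) := by
    intro t ht
    have ht' : (0 : ℝ) < t := ht
    have h3 : ∀ x : ℝ, ((t ^ (k : ℝ) : ℝ) : ℂ) *
        Complex.exp (-((w + a * ((x ^ α : ℝ) : ℂ)) * t)) =
        (((t ^ (k : ℝ) : ℝ) : ℂ) * Complex.exp (-(w * t))) *
          Complex.exp (-((a * t) * ((x ^ α : ℝ) : ℂ))) := by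
      intro x
      rw [mul_assoc, ← Complex.exp_add]
      congr 2
      ring
    simp_rw [h3]
    rw [integral_const_mul, integral_cexp_neg_mul_rpow hα0 (by simp; positivity),
      ← Complex.ofReal_neg, mul_ofReal_cpow_of_re_pos ha ht',
      show (k : ℝ) + 1 - 1 / α - 1 = k + -(1 / α) by ring, Real.rpow_add ht']
    push_cast
    ring
  rw [setIntegral_congr_fun measurableSet_Ioi h1, integral_const_mul,
    integral_integral_swap (integrable_prod_rpow_mul_cexp hα hw ha k),
    setIntegral_congr_fun measurableSet_Ioi h2, integral_const_mul,
    integral_rpow_mul_cexp_neg_mul (by linarith) hw]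
  ring

/-! ### Transfer from the singularity at `1` to Taylor coefficients -/

/-- The binomial coefficient is `∏_{j<n} (p+j) / n!`, the reciprocal of Euler's Gamma sequence up to
powers of `n`; the latter has one more factor `p + n`, which produces `n / (p+n)`. -/
theorem choose_mul_gammaSeq {p : ℝ} (hp : 0 < p) {n : ℕ} (hn : n ≠ 0) :
    Ring.choose ((p : ℂ) + n - 1) n / (n : ℂ) ^ ((p : ℂ) - 1) =
      (n : ℂ) / ((p : ℂ) + n) * (Complex.GammaSeq p n)⁻¹ := by
  have hne : ∀ j : ℕ, (p : ℂ) + j ≠ 0 := by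
    intro j
    have : (p : ℂ) + j = ((p + j : ℝ) : ℂ) := by push_cast; rfl
    rw [this]
    exact_mod_cast (by positivity : (p + j : ℝ) ≠ 0)
  have hprod : ∀ n : ℕ, (n.factorial : ℂ) * Ring.choose ((p : ℂ) + n - 1) n =
      ∏ j ∈ Finset.range n, ((p : ℂ) + j) := by
    intro n
    rw [← Ring.multichoose_eq, ← nsmul_eq_mul, Ring.factorial_nsmul_multichoose_eq_ascPochhammer,
      Polynomial.ascPochhammer_smeval_eq_eval]
    induction n with
    | zero => simp
    | succ m ih => rw [ascPochhammer_succ_eval, ih, Finset.prod_range_succ]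
  have hn0 : (n : ℂ) ≠ 0 := by exact_mod_cast hn
  have hfac : (n.factorial : ℂ) ≠ 0 := by exact_mod_cast n.factorial_ne_zero
  have hpr : ∏ j ∈ Finset.range n, ((p : ℂ) + j) ≠ 0 := Finset.prod_ne_zero_iff.2 fun j _ => hne j
  have hpow : (n : ℂ) ^ (p : ℂ) ≠ 0 := by simp [Complex.cpow_eq_zero_iff, hn0]
  have hc : Ring.choose ((p : ℂ) + n - 1) n =
      (∏ j ∈ Finset.range n, ((p : ℂ) + j)) / n.factorial := by
    rw [← hprod]; field_simp
  rw [hc, Complex.GammaSeq, Finset.prod_range_succ, Complex.cpow_sub _ _ hn0, Complex.cpow_one]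
  have := hne n
  field_simp

/-- The Taylor coefficients of `(1 - z) ^ (-p)`. -/
theorem tendsto_choose_div_rpow {p : ℝ} (hp : 0 < p) :
    Tendsto (fun n : ℕ => Ring.choose ((p : ℂ) + n - 1) n / (n : ℂ) ^ ((p : ℂ) - 1)) atTop
      (𝓝 (Complex.Gamma p)⁻¹) := by
  have hG : Complex.Gamma p ≠ 0 := Complex.Gamma_ne_zero_of_re_pos (by simpa using hp)
  have h1 : Tendsto (fun n : ℕ => (n : ℂ) / ((p : ℂ) + n)) atTop (𝓝 1) := by
    simpa [add_comm] using tendsto_natCast_div_add_atTop (𝕜 := ℂ) (p : ℂ)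
  have h2 := h1.mul ((Complex.GammaSeq_tendsto_Gamma p).inv₀ hG)
  rw [one_mul] at h2
  refine h2.congr' ?_
  filter_upwards [eventually_ne_atTop 0] with n hn
  exact (choose_mul_gammaSeq hp hn).symm

/-- The distance to `1` is at least `1 - R`, and at least the chord `(2/π)|t|` (Jordan's inequality)
minus `1 - R`. Twice the first bound plus the second gives the constant, with its factor `3`. -/
theorem le_norm_one_sub_circleMap {R t : ℝ} (hR : R ≤ 1) (ht : |t| ≤ Real.pi) (hR0 : 0 ≤ R) :
    2 / (3 * Real.pi) * ((1 - R) + |t|) ≤ ‖1 - circleMap 0 R t‖ := by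
  have hpi := Real.pi_gt_three
  have h1 : 1 - R ≤ ‖1 - circleMap 0 R t‖ := by
    have := norm_sub_norm_le (1 : ℂ) (circleMap 0 R t)
    simpa [abs_of_nonneg hR0] using this
  have h2 : 2 / Real.pi * |t| ≤ ‖1 - circleMap 0 1 t‖ := by
    have h := Complex.norm_exp_I_mul_ofReal_sub_one t
    have h3 := Real.mul_abs_le_abs_sin (x := t / 2) (by rw [abs_div, abs_two]; linarith)
    rw [norm_sub_rev, circleMap]
    rw [mul_comm] at h
    simp only [Complex.ofReal_one, one_mul, zero_add]
    rw [h, norm_mul, Real.norm_eq_abs, Real.norm_eq_abs, abs_two]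
    rw [abs_div, abs_two] at h3
    linarith
  have h3 : ‖1 - circleMap 0 1 t‖ ≤ ‖1 - circleMap 0 R t‖ + (1 - R) := by
    have : 1 - circleMap 0 1 t = (1 - circleMap 0 R t) + ((R - 1 : ℝ) : ℂ) * circleMap 0 1 t := by
      simp [circleMap]; ring
    rw [this]
    refine (norm_add_le _ _).trans ?_
    rw [norm_mul, Complex.norm_real, Real.norm_eq_abs, abs_of_nonpos (by linarith)]
    simp
  have h4 : 2 / (3 * Real.pi) = 2 / Real.pi / 3 := by field_simp
  have h5 : 2 / Real.pi ≤ 1 := by rw [div_le_one (by linarith)]; linarith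
  have h6 : 2 / Real.pi * (1 - R) ≤ 1 * (1 - R) :=
    mul_le_mul_of_nonneg_right h5 (by linarith)
  rw [h4]
  linarith

/-- Cauchy's estimate with the mean of `‖H‖` over the circle. The maximum would lose a factor `n`:
at radius `1 - 1/n` the function `|1-s|^(-p)` has maximum `n^p` but, for `p > 1`, mean of order
`n^(p-1)`. The indicator prepares a rescaling on the whole line. -/
theorem norm_iteratedDeriv_div_factorial_le {H : ℂ → ℂ}
    (hd : DifferentiableOn ℂ H (Metric.ball 0 1)) {R : ℝ} (hR0 : 0 < R) (hR1 : R < 1) (n : ℕ) :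
    ‖iteratedDeriv n H 0 / n.factorial‖ ≤
      ((2 * Real.pi)⁻¹ * ∫ t, (Set.Ioc (-Real.pi) Real.pi).indicator
        (fun t => ‖H (circleMap 0 R t)‖) t) * R⁻¹ ^ n := by
  lift R to NNReal using hR0.le
  have h1 : HasFPowerSeriesOnBall H (cauchyPowerSeries H 0 R) 0 R :=
    (hd.mono (Metric.closedBall_subset_ball hR1)).hasFPowerSeriesOnBall (by exact_mod_cast hR0)
  have h2 := h1.analyticAt.hasFPowerSeriesAt.eq_formalMultilinearSeries h1.hasFPowerSeriesAt
  have h3 := norm_cauchyPowerSeries_le H 0 R n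
  rw [← h2, FormalMultilinearSeries.ofScalars_norm, abs_of_pos hR0] at h3
  refine h3.trans (le_of_eq ?_)
  congr 2
  have hper : Function.Periodic (fun t => ‖H (circleMap 0 R t)‖) (2 * Real.pi) := fun t => by
    simp only [periodic_circleMap 0 R t]
  have h4 := hper.intervalIntegral_add_eq 0 (-Real.pi)
  rw [zero_add, show -Real.pi + 2 * Real.pi = Real.pi by ring] at h4
  rw [h4, intervalIntegral.integral_of_le (by linarith [Real.pi_pos]),
    integral_indicator measurableSet_Ioc]

/-- Put `t = x/n`: then `|1-s|` is at least a multiple of `(1+|x|)/n`, so the rescaled integrand is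
dominated by a multiple of `(1+|x|)^(-p)`, integrable since `p > 1`. For fixed `x` the point tends
to `1` and the integrand to `0`. -/
theorem tendsto_scaled_circle_integral {H : ℂ → ℂ} {p K : ℝ} (hp : 1 < p)
    (hd : DifferentiableOn ℂ H (Metric.ball 0 1))
    (hlim : Tendsto (fun s : ℂ => ‖1 - s‖ ^ p * ‖H s‖) (𝓝[Metric.ball 0 1] 1) (𝓝 0))
    (hK : ∀ s ∈ Metric.ball (0 : ℂ) 1, ‖1 - s‖ ^ p * ‖H s‖ ≤ K) :
    Tendsto (fun n : ℕ => ((n : ℝ) ^ (p - 1))⁻¹ * ∫ t, (Set.Ioc (-Real.pi) Real.pi).indicator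
        (fun t => ‖H (circleMap 0 (1 - (n : ℝ)⁻¹) t)‖) t) atTop (𝓝 0) := by
  set c : ℝ := 2 / (3 * Real.pi) with hc
  have hc0 : 0 < c := by have := Real.pi_pos; positivity
  have hR : ∀ n : ℕ, 2 ≤ n → 0 < 1 - (n : ℝ)⁻¹ ∧ 1 - (n : ℝ)⁻¹ < 1 := by
    intro n hn
    have h2 : (2 : ℝ) ≤ n := by exact_mod_cast hn
    have : (n : ℝ)⁻¹ ≤ 2⁻¹ := by gcongr
    have : 0 < (n : ℝ)⁻¹ := by positivity
    constructor <;> linarith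
  have hball : ∀ n : ℕ, 2 ≤ n → ∀ t : ℝ,
      circleMap 0 (1 - (n : ℝ)⁻¹) t ∈ Metric.ball (0 : ℂ) 1 := by
    intro n hn t
    simp [abs_of_pos (hR n hn).1, (hR n hn).2]
  have key : ∀ n : ℕ, 2 ≤ n → ∀ x : ℝ, |x / n| ≤ Real.pi →
      ((n : ℝ) ^ p)⁻¹ * ‖H (circleMap 0 (1 - (n : ℝ)⁻¹) (x / n))‖ ≤
      c ^ (-p) * (1 + ‖x‖) ^ (-p) * (‖1 - circleMap 0 (1 - (n : ℝ)⁻¹) (x / n)‖ ^ p *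
        ‖H (circleMap 0 (1 - (n : ℝ)⁻¹) (x / n))‖) := by
    intro n hn x hx
    have hn0 : (0 : ℝ) < n := by positivity
    have h1 := le_norm_one_sub_circleMap (hR n hn).2.le hx (hR n hn).1.le
    rw [← hc] at h1
    have h2 : c * (1 + ‖x‖) ≤ n * ‖1 - circleMap 0 (1 - (n : ℝ)⁻¹) (x / n)‖ := by
      refine le_trans (le_of_eq ?_) (mul_le_mul_of_nonneg_left h1 hn0.le)
      rw [abs_div, abs_of_pos hn0, Real.norm_eq_abs]
      field_simp
      ring
    have h3 : (c * (1 + ‖x‖)) ^ p ≤ (n * ‖1 - circleMap 0 (1 - (n : ℝ)⁻¹) (x / n)‖) ^ p :=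
      Real.rpow_le_rpow (by positivity) h2 (by linarith)
    rw [Real.mul_rpow hc0.le (by positivity), Real.mul_rpow hn0.le (norm_nonneg _)] at h3
    rw [Real.rpow_neg hc0.le, Real.rpow_neg (by positivity), ← mul_assoc]
    refine mul_le_mul_of_nonneg_right ?_ (norm_nonneg _)
    rw [← mul_inv, inv_mul_eq_div, inv_eq_one_div, div_le_div_iff₀ (by positivity) (by positivity)]
    linarith
  have hscale : ∀ᶠ n : ℕ in atTop, (∫ x : ℝ, ((n : ℝ) ^ p)⁻¹ *
      (Set.Ioc (-Real.pi) Real.pi).indicator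
        (fun t => ‖H (circleMap 0 (1 - (n : ℝ)⁻¹) t)‖) (x / n)) =
      ((n : ℝ) ^ (p - 1))⁻¹ * ∫ t, (Set.Ioc (-Real.pi) Real.pi).indicator
        (fun t => ‖H (circleMap 0 (1 - (n : ℝ)⁻¹) t)‖) t := by
    filter_upwards [eventually_ge_atTop 2] with n hn
    have hn0 : (0 : ℝ) < n := by positivity
    rw [integral_const_mul, Measure.integral_comp_div (fun t => (Set.Ioc (-Real.pi)
      Real.pi).indicator (fun t => ‖H (circleMap 0 (1 - (n : ℝ)⁻¹) t)‖) t), smul_eq_mul,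
      ← mul_assoc, abs_of_pos hn0, Real.rpow_sub_one hn0.ne']
    congr 1
    field_simp
  refine Tendsto.congr' hscale ?_
  rw [← integral_zero ℝ ℝ]
  have hKnn : 0 ≤ K := le_trans (by positivity) (hK 0 (by simp))
  refine tendsto_integral_filter_of_dominated_convergence
    (fun x => c ^ (-p) * (1 + ‖x‖) ^ (-p) * K) ?_ ?_ ?_ ?_
  · filter_upwards [eventually_ge_atTop 2] with n hn
    refine Measurable.aestronglyMeasurable ?_
    have h1 : Continuous fun t => ‖H (circleMap 0 (1 - (n : ℝ)⁻¹) t)‖ :=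
      (hd.continuousOn.comp_continuous (continuous_circleMap _ _) (hball n hn)).norm
    exact ((h1.measurable.indicator measurableSet_Ioc).comp (measurable_id.div_const _)).const_mul _
  · filter_upwards [eventually_ge_atTop 2] with n hn
    refine Eventually.of_forall fun x => ?_
    by_cases hx : x / n ∈ Set.Ioc (-Real.pi) Real.pi
    · rw [Set.indicator_of_mem hx, Real.norm_of_nonneg (by positivity)]
      refine (key n hn x (abs_le.2 ⟨hx.1.le, hx.2⟩)).trans ?_
      gcongr
      exact hK _ (hball n hn _)
    · rw [Set.indicator_of_notMem hx]
      simp only [mul_zero, norm_zero]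
      positivity
  · exact ((integrable_one_add_norm (by simpa using hp)).const_mul _).mul_const _
  · refine Eventually.of_forall fun x => ?_
    have hninv : Tendsto (fun n : ℕ => (n : ℝ)⁻¹) atTop (𝓝 0) :=
      tendsto_inv_atTop_zero.comp tendsto_natCast_atTop_atTop
    have hxn : Tendsto (fun n : ℕ => x / n) atTop (𝓝 0) := by
      simpa [div_eq_mul_inv] using hninv.const_mul x
    have hs : Tendsto (fun n : ℕ => circleMap 0 (1 - (n : ℝ)⁻¹) (x / n)) atTop
        (𝓝[Metric.ball 0 1] 1) := by
      refine tendsto_nhdsWithin_iff.2 ⟨?_, ?_⟩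
      · have h1 : Tendsto (fun n : ℕ => ((1 - (n : ℝ)⁻¹ : ℝ) : ℂ) *
            Complex.exp (((x / n : ℝ) : ℂ) * Complex.I)) atTop
            (𝓝 (((1 - 0 : ℝ) : ℂ) * Complex.exp (((0 : ℝ) : ℂ) * Complex.I))) := by
          refine Tendsto.mul ?_ ?_
          · exact (Complex.continuous_ofReal.tendsto _).comp (hninv.const_sub 1)
          · have : Continuous fun y : ℝ => Complex.exp ((y : ℂ) * Complex.I) := by fun_prop
            exact (this.tendsto 0).comp hxn
        simpa [circleMap] using h1
      · filter_upwards [eventually_ge_atTop 2] with n hn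
        exact hball n hn _
    have h1 := (hlim.comp hs).const_mul (c ^ (-p) * (1 + ‖x‖) ^ (-p))
    rw [mul_zero] at h1
    refine tendsto_of_tendsto_of_tendsto_of_le_of_le' tendsto_const_nhds h1 ?_ ?_
    · refine Eventually.of_forall fun n => ?_
      exact mul_nonneg (by positivity) (Set.indicator_nonneg (fun _ _ => norm_nonneg _) _)
    · filter_upwards [eventually_ge_atTop 2] with n hn
      by_cases hx : x / n ∈ Set.Ioc (-Real.pi) Real.pi
      · rw [Set.indicator_of_mem hx]
        exact key n hn x (abs_le.2 ⟨hx.1.le, hx.2⟩)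
      · rw [Set.indicator_of_notMem hx, mul_zero]
        simp only [Function.comp]
        positivity

/-- If `H` is holomorphic in the unit disc and `o(|1 - s| ^ (-p))` at its only singularity `1`, then
its Taylor coefficients are `o(n ^ (p - 1))`. -/
theorem tendsto_coeff_of_isLittleO {H : ℂ → ℂ} {p K : ℝ} (hp : 1 < p)
    (hd : DifferentiableOn ℂ H (Metric.ball 0 1))
    (hlim : Tendsto (fun s : ℂ => ‖1 - s‖ ^ p * ‖H s‖) (𝓝[Metric.ball 0 1] 1) (𝓝 0))
    (hK : ∀ s ∈ Metric.ball (0 : ℂ) 1, ‖1 - s‖ ^ p * ‖H s‖ ≤ K) :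
    Tendsto (fun n : ℕ => iteratedDeriv n H 0 / n.factorial / (n : ℂ) ^ ((p : ℂ) - 1)) atTop
      (𝓝 0) := by
  rw [tendsto_zero_iff_norm_tendsto_zero]
  have h1 := tendsto_scaled_circle_integral hp hd hlim hK
  -- The radius `1 - 1/n` keeps the Cauchy factor `R^(-n)` bounded: it tends to `e`.
  have h2 : Tendsto (fun n : ℕ => (1 - (n : ℝ)⁻¹)⁻¹ ^ n) atTop (𝓝 (Real.exp (-1))⁻¹) := by
    refine ((Real.tendsto_one_add_div_pow_exp (-1)).inv₀ (Real.exp_pos _).ne').congr fun n => ?_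
    rw [inv_pow]
    congr 2
    ring
  have h3 := (h1.mul h2).const_mul (2 * Real.pi)⁻¹
  rw [zero_mul, mul_zero] at h3
  refine tendsto_of_tendsto_of_tendsto_of_le_of_le' tendsto_const_nhds h3
    (Eventually.of_forall fun n => norm_nonneg _) ?_
  filter_upwards [eventually_ge_atTop 2] with n hn
  have hn2 : (2 : ℝ) ≤ n := by exact_mod_cast hn
  have h4 : (n : ℝ)⁻¹ ≤ 2⁻¹ := by gcongr
  have h5 : 0 < (n : ℝ)⁻¹ := by positivity
  have h6 := norm_iteratedDeriv_div_factorial_le hd (R := 1 - (n : ℝ)⁻¹) (by linarith)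
    (by linarith) n
  have h7 : ‖(n : ℂ) ^ ((p : ℂ) - 1)‖ = (n : ℝ) ^ (p - 1) := by
    rw [show (p : ℂ) - 1 = ((p - 1 : ℝ) : ℂ) by push_cast; rfl, Complex.norm_cpow_real]
    simp
  rw [norm_div, h7, div_eq_inv_mul]
  refine (mul_le_mul_of_nonneg_left h6 (by positivity)).trans (le_of_eq ?_)
  ring

/-- Transfer of a power singularity at `1` to the Taylor coefficients. -/
theorem tendsto_coeff_of_singularity {G : ℂ → ℂ} {p : ℝ} {L : ℂ} (hp : 1 < p)
    (hd : DifferentiableOn ℂ G (Metric.ball 0 1))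
    (hlim : Tendsto (fun s : ℂ => (1 - s) ^ (p : ℂ) * G s) (𝓝[Metric.ball 0 1] 1) (𝓝 L))
    (hbd : ∀ δ > 0, ∃ K, ∀ s ∈ Metric.ball (0 : ℂ) 1, δ ≤ ‖1 - s‖ → ‖G s‖ ≤ K) :
    Tendsto (fun n : ℕ => iteratedDeriv n G 0 / n.factorial / (n : ℂ) ^ ((p : ℂ) - 1)) atTop
      (𝓝 (L * (Complex.Gamma p)⁻¹)) := by
  have hne : ∀ s ∈ Metric.ball (0 : ℂ) 1, 1 - s ≠ 0 := by
    intro s hs h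
    rw [sub_eq_zero] at h
    simp [← h] at hs
  have hslit : ∀ s ∈ Metric.ball (0 : ℂ) 1, 1 - s ∈ Complex.slitPlane := by
    intro s hs
    rw [sub_eq_add_neg]
    exact Complex.mem_slitPlane_of_norm_lt_one (by simpa using hs)
  have hpow : ∀ s ∈ Metric.ball (0 : ℂ) 1, (1 - s) ^ (p : ℂ) ≠ 0 := by
    intro s hs
    simp [Complex.cpow_eq_zero_iff, hne s hs]
  set B : ℂ → ℂ := fun s => 1 / (1 - s) ^ (p : ℂ) with hB
  have hBps := Complex.one_div_one_sub_cpow_hasFPowerSeriesOnBall_zero (p : ℂ)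
  have hBd : DifferentiableOn ℂ B (Metric.ball 0 1) := by
    intro s hs
    have h : DifferentiableAt ℂ (fun s : ℂ => (1 - s) ^ (p : ℂ)) s :=
      ((differentiableAt_const _).sub differentiableAt_id).cpow_const (hslit s hs)
    exact ((differentiableAt_const (1 : ℂ)).fun_div h (hpow s hs)).differentiableWithinAt
  -- Removing the exact singular part leaves a function that is `o(|1-s|^(-p))`.
  set H : ℂ → ℂ := fun s => G s - L * B s with hH
  have hnorm : ∀ s ∈ Metric.ball (0 : ℂ) 1,
      ‖1 - s‖ ^ p * ‖H s‖ = ‖(1 - s) ^ (p : ℂ) * G s - L‖ := by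
    intro s hs
    rw [← Complex.norm_cpow_real, ← norm_mul]
    congr 1
    simp only [hH, hB]
    have := hpow s hs
    field_simp
  have hHd : DifferentiableOn ℂ H (Metric.ball 0 1) := hd.sub (hBd.const_mul L)
  have hHlim : Tendsto (fun s : ℂ => ‖1 - s‖ ^ p * ‖H s‖) (𝓝[Metric.ball 0 1] 1) (𝓝 0) := by
    have h := (hlim.sub_const L).norm
    rw [sub_self, norm_zero] at h
    refine h.congr' ?_
    filter_upwards [self_mem_nhdsWithin] with s hs
    exact (hnorm s hs).symm
  obtain ⟨K, hK⟩ : ∃ K, ∀ s ∈ Metric.ball (0 : ℂ) 1, ‖1 - s‖ ^ p * ‖H s‖ ≤ K := by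
    -- Near `1` the bound comes from the limit, away from `1` from `hbd`, with `‖1 - s‖ ≤ 2` on the
    -- disc.
    have h1 := hHlim.eventually (gt_mem_nhds one_pos)
    rw [eventually_nhdsWithin_iff, Metric.eventually_nhds_iff] at h1
    obtain ⟨δ, hδ, h1⟩ := h1
    obtain ⟨K, hK⟩ := hbd δ hδ
    refine ⟨max 1 (2 ^ p * K + ‖L‖), fun s hs => ?_⟩
    rcases lt_or_ge ‖1 - s‖ δ with h | h
    · exact (h1 (by rwa [dist_eq_norm, norm_sub_rev]) hs).le.trans (le_max_left _ _)
    · refine le_trans ?_ (le_max_right _ _)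
      rw [hnorm s hs]
      refine (norm_sub_le _ _).trans ?_
      rw [norm_mul, Complex.norm_cpow_real]
      have h2 : ‖1 - s‖ ≤ 2 := by
        refine (norm_sub_le _ _).trans ?_
        have : ‖s‖ < 1 := by simpa using hs
        simp
        linarith
      have := hK s hs h
      gcongr
  have h1 := tendsto_coeff_of_isLittleO hp hHd hHlim hK
  have h2 := (tendsto_choose_div_rpow (p := p) (by linarith)).const_mul L
  have h3 := h1.add h2
  rw [zero_add] at h3
  refine h3.congr fun n => ?_
  have h0 : Metric.ball (0 : ℂ) 1 ∈ 𝓝 0 := Metric.ball_mem_nhds _ one_pos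
  have hBcoeff : iteratedDeriv n B 0 = n.factorial * Ring.choose ((p : ℂ) + n - 1) n := by
    have h := hBps.analyticAt.hasFPowerSeriesAt.eq_formalMultilinearSeries hBps.hasFPowerSeriesAt
    have h := congrFun ((FormalMultilinearSeries.ofScalars_series_eq_iff _ _ _).1 h) n
    have hfac : (n.factorial : ℂ) ≠ 0 := by exact_mod_cast n.factorial_ne_zero
    rw [← h]
    simp only [hB]
    field_simp
  have hsum : iteratedDeriv n G 0 = iteratedDeriv n H 0 + L * iteratedDeriv n B 0 := by
    have hHa : ContDiffAt ℂ n H 0 := (hHd.analyticAt h0).contDiffAt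
    have hBa : ContDiffAt ℂ n B 0 := (hBd.analyticAt h0).contDiffAt
    have : G = H + fun s => L * B s := by
      ext s; simp [hH]
    conv_lhs => rw [this]
    rw [iteratedDeriv_add hHa (contDiffAt_const.mul hBa), iteratedDeriv_const_mul_field]
  rw [hsum, hBcoeff]
  have hfac : (n.factorial : ℂ) ≠ 0 := by exact_mod_cast n.factorial_ne_zero
  field_simp

/-! ### Stable symbols and the lower bound for the resolvent kernel -/

/-- A continuous function on the line, of modulus less than one on `[-π, π]` off the origin, such
that `1 - φ θ` is equivalent to `a |θ| ^ α` as `θ → 0+` and to `conj a |θ| ^ α` as `θ → 0-`. -/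
structure IsStableSymbol (φ : ℝ → ℂ) (α : ℝ) (a : ℂ) : Prop where
  continuous : Continuous φ
  norm_le_one : ∀ θ, ‖φ θ‖ ≤ 1
  norm_lt_one : ∀ θ, |θ| ≤ Real.pi → θ ≠ 0 → ‖φ θ‖ < 1
  map_zero : φ 0 = 1
  one_lt : 1 < α
  re_pos : 0 < a.re
  right : Tendsto (fun θ : ℝ => (1 - φ θ) / ((|θ| ^ α : ℝ) : ℂ)) (𝓝[>] 0) (𝓝 a)
  left : Tendsto (fun θ : ℝ => (1 - φ θ) / ((|θ| ^ α : ℝ) : ℂ)) (𝓝[<] 0) (𝓝 (starRingEnd ℂ a))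

/-- The function equal to `a` on the positive half-line and to its conjugate on the rest. -/
noncomputable def sideCoeff (a : ℂ) (θ : ℝ) : ℂ := if 0 < θ then a else starRingEnd ℂ a

theorem re_sideCoeff (a : ℂ) (θ : ℝ) : (sideCoeff a θ).re = a.re := by
  unfold sideCoeff; split_ifs <;> simp

theorem norm_sideCoeff (a : ℂ) (θ : ℝ) : ‖sideCoeff a θ‖ = ‖a‖ := by
  unfold sideCoeff; split_ifs <;> simp

theorem sideCoeff_mul (a : ℂ) {ε : ℝ} (hε : 0 < ε) (θ : ℝ) :
    sideCoeff a (ε * θ) = sideCoeff a θ := by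
  simp [sideCoeff, hε]

theorem measurable_sideCoeff (a : ℂ) : Measurable (sideCoeff a) :=
  Measurable.ite measurableSet_Ioi measurable_const measurable_const

/-- If `w` lies in the right half-plane and `z` in a smaller sector, there is no cancellation in
`w + z`. -/
theorem le_norm_add_of_re {w z : ℂ} {κ K T : ℝ} (hκ : 0 ≤ κ) (hK : 0 ≤ K) (hw : 0 ≤ w.re)
    (hz : κ * T ≤ z.re) (hz' : ‖z‖ ≤ K * T) : κ / (1 + K + κ) * (‖w‖ + T) ≤ ‖w + z‖ := by
  have h1 : κ * T ≤ ‖w + z‖ := by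
    have := Complex.re_le_norm (w + z)
    rw [Complex.add_re] at this
    linarith
  have h2 : ‖w‖ - K * T ≤ ‖w + z‖ := by
    have := norm_sub_le (w + z) z
    rw [add_sub_cancel_right] at this
    linarith
  -- With `N = ‖w + z‖`: `κ‖w‖ ≤ κN + KκT ≤ κN + KN`, and `κT ≤ N`.
  rw [div_mul_eq_mul_div, div_le_iff₀ (by positivity)]
  nlinarith [mul_le_mul_of_nonneg_left h2 hκ, mul_le_mul_of_nonneg_left h1 hK]

theorem one_sub_re_nonneg {s : ℂ} (hs : ‖s‖ ≤ 1) : 0 ≤ (1 - s).re := by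
  have := (Complex.re_le_norm s).trans hs
  simpa using this

namespace IsStableSymbol

variable {φ : ℝ → ℂ} {α : ℝ} {a : ℂ}

theorem tendsto_sub_sideCoeff (h : IsStableSymbol φ α a) :
    Tendsto (fun θ : ℝ => (1 - φ θ) / ((|θ| ^ α : ℝ) : ℂ) - sideCoeff a θ) (𝓝[≠] 0) (𝓝 0) := by
  rw [← Set.Iio_union_Ioi, nhdsWithin_union]
  refine Tendsto.sup ?_ ?_
  · have := h.left.sub_const (starRingEnd ℂ a)
    rw [sub_self] at this
    refine this.congr' ?_
    filter_upwards [self_mem_nhdsWithin] with θ hθ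
    simp [sideCoeff, not_lt.2 (le_of_lt (Set.mem_Iio.1 hθ))]
  · have := h.right.sub_const a
    rw [sub_self] at this
    refine this.congr' ?_
    filter_upwards [self_mem_nhdsWithin] with θ hθ
    simp [sideCoeff, Set.mem_Ioi.1 hθ]

/-- Close to the origin `1 - φ` lies in a fixed sector strictly inside the right half-plane, with
size of order `|θ|^α`; these are the hypotheses on `z` in `le_norm_add_of_re`. -/
theorem eventually_one_sub (h : IsStableSymbol φ α a) :
    ∀ᶠ θ in 𝓝 (0 : ℝ), a.re / 2 * |θ| ^ α ≤ (1 - φ θ).re ∧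
      ‖1 - φ θ‖ ≤ (‖a‖ + a.re) * |θ| ^ α := by
  have h1 := h.tendsto_sub_sideCoeff.norm
  rw [norm_zero] at h1
  have h2 := h1.eventually (gt_mem_nhds (half_pos h.re_pos))
  rw [eventually_nhdsWithin_iff] at h2
  filter_upwards [h2] with θ hθ
  have hα0 : α ≠ 0 := by have := h.one_lt; linarith
  rcases eq_or_ne θ 0 with rfl | hne
  · simp [h.map_zero, Real.zero_rpow hα0]
  have hT : 0 < |θ| ^ α := Real.rpow_pos_of_pos (abs_pos.2 hne) _
  have h3 := (hθ hne).le
  set q := (1 - φ θ) / ((|θ| ^ α : ℝ) : ℂ) with hq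
  have h4 : 1 - φ θ = ((|θ| ^ α : ℝ) : ℂ) * q := by
    rw [hq, mul_div_cancel₀]
    exact_mod_cast hT.ne'
  rw [h4]
  constructor
  · rw [Complex.re_ofReal_mul, mul_comm]
    refine mul_le_mul_of_nonneg_left ?_ hT.le
    have h5 := (Complex.abs_re_le_norm _).trans h3
    rw [Complex.sub_re, re_sideCoeff] at h5
    linarith [(abs_le.1 h5).1]
  · rw [norm_mul, Complex.norm_real, Real.norm_of_nonneg hT.le, mul_comm]
    refine mul_le_mul_of_nonneg_right ?_ hT.le
    have h5 := norm_le_norm_add_norm_sub' q (sideCoeff a θ)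
    rw [norm_sideCoeff] at h5
    linarith [h.re_pos]

/-- The resolvent kernel is comparable to that of the limiting stable law. -/
theorem exists_le_norm_one_sub_mul (h : IsStableSymbol φ α a) :
    ∃ c > 0, ∀ s : ℂ, ‖s‖ ≤ 1 → ∀ θ : ℝ, |θ| ≤ Real.pi →
      c * (‖1 - s‖ + |θ| ^ α) ≤ ‖1 - s * φ θ‖ := by
  have hα0 : 0 < α := by have := h.one_lt; linarith
  have hκ := h.re_pos
  set K := ‖a‖ + a.re with hK
  have hK0 : 0 < K := by positivity
  set l := a.re / 2 / (1 + K + a.re / 2) with hl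
  have hl0 : 0 < l := by positivity
  have hsmall : ∀ᶠ θ in 𝓝 (0 : ℝ), K * |θ| ^ α < l / 2 := by
    have : Tendsto (fun θ : ℝ => K * |θ| ^ α) (𝓝 0) (𝓝 (K * |(0 : ℝ)| ^ α)) := by
      refine Continuous.tendsto ?_ 0
      exact continuous_const.mul (continuous_abs.rpow_const fun _ => Or.inr hα0.le)
    rw [abs_zero, Real.zero_rpow hα0.ne', mul_zero] at this
    exact this.eventually (gt_mem_nhds (half_pos hl0))
  obtain ⟨δ, hδ, hloc⟩ := Metric.eventually_nhds_iff.1 (h.eventually_one_sub.and hsmall)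
  -- Away from the origin, compactness turns `‖φ‖ < 1` into a uniform bound.
  obtain ⟨r, hr1, hr⟩ : ∃ r < 1, ∀ θ, |θ| ≤ Real.pi → δ ≤ |θ| → ‖φ θ‖ ≤ r := by
    have hS : IsCompact {θ : ℝ | |θ| ≤ Real.pi ∧ δ ≤ |θ|} := by
      refine Metric.isCompact_of_isClosed_isBounded ?_ ?_
      · exact (isClosed_le continuous_abs continuous_const).inter
          (isClosed_le continuous_const continuous_abs)
      · refine (Metric.isBounded_closedBall (x := (0 : ℝ)) (r := Real.pi)).subset ?_
        intro θ hθ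
        simpa using hθ.1
    rcases Set.eq_empty_or_nonempty {θ : ℝ | |θ| ≤ Real.pi ∧ δ ≤ |θ|} with he | hne
    · exact ⟨0, one_pos, fun θ h1 h2 => absurd (show θ ∈ {θ : ℝ | |θ| ≤ Real.pi ∧ δ ≤ |θ|} from
        ⟨h1, h2⟩) (by simp [he])⟩
    · obtain ⟨θ₀, hθ₀, hmax⟩ := hS.exists_isMaxOn hne h.continuous.norm.continuousOn
      refine ⟨‖φ θ₀‖, h.norm_lt_one _ hθ₀.1 ?_, fun θ h1 h2 => hmax ⟨h1, h2⟩⟩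
      intro h0
      have := hθ₀.2
      rw [h0, abs_zero] at this
      linarith
  -- For `|θ| ≥ δ` the kernel is at least `1 - r`, while `‖1 - s‖ + |θ|^α ≤ 2 + π^α`. For `|θ| < δ`
  -- half of the sector constant `l` survives.
  refine ⟨min (l / 2) ((1 - r) / (2 + Real.pi ^ α)), lt_min (by positivity)
    (div_pos (by linarith) (by positivity)), fun s hs θ hθ => ?_⟩
  have hT : 0 ≤ |θ| ^ α := by positivity
  rcases lt_or_ge |θ| δ with hlt | hge
  · obtain ⟨⟨h1, h2⟩, h3⟩ := hloc (by simpa using hlt : dist θ 0 < δ)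
    have h4 := le_norm_add_of_re (half_pos hκ).le hK0.le (one_sub_re_nonneg hs) h1 h2
    -- The cross term `(1-s)(1-φ)` is at most `(l/2)‖1-s‖` and is absorbed by the main term.
    have h5 : 1 - s * φ θ = (1 - s + (1 - φ θ)) - (1 - s) * (1 - φ θ) := by ring
    have h6 := norm_sub_norm_le (1 - s + (1 - φ θ)) ((1 - s) * (1 - φ θ))
    rw [← h5, norm_mul] at h6
    have h7 : ‖1 - s‖ * ‖1 - φ θ‖ ≤ ‖1 - s‖ * (l / 2) :=
      mul_le_mul_of_nonneg_left (h2.trans h3.le) (norm_nonneg _)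
    refine (mul_le_mul_of_nonneg_right (min_le_left _ _) (by positivity)).trans ?_
    have h8 : 0 ≤ l * |θ| ^ α := by positivity
    have h9 : l * (‖1 - s‖ + |θ| ^ α) ≤ ‖1 - s + (1 - φ θ)‖ := h4
    linarith
  · refine (mul_le_mul_of_nonneg_right (min_le_right _ _) (by positivity)).trans ?_
    have h1 : ‖1 - s‖ ≤ 2 := by
      refine (norm_sub_le _ _).trans ?_
      simp
      linarith
    have h2 : |θ| ^ α ≤ Real.pi ^ α := Real.rpow_le_rpow (abs_nonneg _) hθ hα0.le
    have h3 : ‖s * φ θ‖ ≤ r := by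
      rw [norm_mul]
      calc ‖s‖ * ‖φ θ‖ ≤ 1 * ‖φ θ‖ := by gcongr
        _ ≤ r := by rw [one_mul]; exact hr θ hθ hge
    have h4 := norm_sub_norm_le 1 (s * φ θ)
    rw [norm_one] at h4
    rw [div_mul_eq_mul_div, div_le_iff₀ (by positivity)]
    calc (1 - r) * (‖1 - s‖ + |θ| ^ α) ≤ (1 - r) * (2 + Real.pi ^ α) :=
          mul_le_mul_of_nonneg_left (by linarith) (by linarith)
      _ ≤ _ := mul_le_mul_of_nonneg_right (by linarith) (by positivity)

end IsStableSymbol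

/-! ### The model kernel `w + a|θ|^α` on the whole line -/

theorem exists_le_norm_add_sideCoeff_mul {a : ℂ} (ha : 0 < a.re) :
    ∃ c > 0, ∀ w : ℂ, 0 ≤ w.re → ∀ (θ T : ℝ), 0 ≤ T →
      c * (‖w‖ + T) ≤ ‖w + sideCoeff a θ * (T : ℂ)‖ := by
  refine ⟨a.re / (1 + ‖a‖ + a.re), by positivity, fun w hw θ T hT => ?_⟩
  refine le_norm_add_of_re ha.le (norm_nonneg _) hw ?_ ?_
  · rw [Complex.re_mul_ofReal, re_sideCoeff]
  · rw [norm_mul, norm_sideCoeff, Complex.norm_real, Real.norm_of_nonneg hT]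

theorem integrable_inv_one_add_abs_rpow {α : ℝ} (hα : 1 < α) :
    Integrable (fun x : ℝ => (1 + |x| ^ α)⁻¹) := by
  have h1 : Integrable (fun x : ℝ => 2 ^ α * (1 + ‖x‖) ^ (-α)) :=
    (integrable_one_add_norm (by simpa using hα)).const_mul _
  refine h1.mono' (Measurable.aestronglyMeasurable (by fun_prop)) (Eventually.of_forall fun x => ?_)
  have hα0 : 0 ≤ α := by linarith
  have h2 : (1 + |x|) ^ α ≤ 2 ^ α * (1 + |x| ^ α) := by
    have h3 : 1 + |x| ≤ 2 * max 1 |x| := by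
      linarith [le_max_left 1 |x|, le_max_right 1 |x|]
    refine (Real.rpow_le_rpow (by positivity) h3 hα0).trans ?_
    rw [Real.mul_rpow (by norm_num) (by positivity)]
    refine mul_le_mul_of_nonneg_left ?_ (by positivity)
    rcases le_total 1 |x| with h4 | h4
    · rw [max_eq_right h4]; linarith
    · rw [max_eq_left h4, Real.one_rpow]
      have : 0 ≤ |x| ^ α := by positivity
      linarith
  rw [Real.norm_of_nonneg (by positivity), Real.rpow_neg (by positivity), Real.norm_eq_abs,
    ← div_eq_mul_inv, inv_eq_one_div, div_le_div_iff₀ (by positivity) (by positivity)]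
  linarith

theorem integrable_inv_pow_add_sideCoeff {α : ℝ} (hα : 1 < α) {a w : ℂ} (ha : 0 < a.re)
    (hw : 0 < w.re) (k : ℕ) :
    Integrable (fun θ : ℝ => ((w + sideCoeff a θ * ((|θ| ^ α : ℝ) : ℂ)) ^ (k + 1))⁻¹) := by
  obtain ⟨c, hc, hle⟩ := exists_le_norm_add_sideCoeff_mul ha
  have hw0 : 0 < ‖w‖ := norm_pos_iff.2 fun h => by simp [h] at hw
  set m := c * min ‖w‖ 1 with hm
  have hm0 : 0 < m := mul_pos hc (lt_min hw0 one_pos)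
  refine ((integrable_inv_one_add_abs_rpow hα).const_mul (m ^ (k + 1))⁻¹).mono' ?_ ?_
  · refine Measurable.aestronglyMeasurable ?_
    have := measurable_sideCoeff a
    fun_prop
  · refine Eventually.of_forall fun θ => ?_
    have hT : 0 ≤ |θ| ^ α := by positivity
    have h1 : m * (1 + |θ| ^ α) ≤ ‖w + sideCoeff a θ * ((|θ| ^ α : ℝ) : ℂ)‖ := by
      refine le_trans ?_ (hle w hw.le θ _ hT)
      rw [hm, mul_assoc]
      refine mul_le_mul_of_nonneg_left ?_ hc.le
      have h2 : min ‖w‖ 1 * |θ| ^ α ≤ 1 * |θ| ^ α :=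
        mul_le_mul_of_nonneg_right (min_le_right _ _) hT
      linarith [min_le_left ‖w‖ 1]
    rw [norm_inv, norm_pow]
    calc (‖w + sideCoeff a θ * ((|θ| ^ α : ℝ) : ℂ)‖ ^ (k + 1))⁻¹
        ≤ ((m * (1 + |θ| ^ α)) ^ (k + 1))⁻¹ := by gcongr
      _ = (m ^ (k + 1))⁻¹ * ((1 + |θ| ^ α) ^ (k + 1))⁻¹ := by rw [mul_pow, mul_inv]
      _ ≤ _ := by
        gcongr
        exact le_self_pow₀ (by linarith) (by omega)

theorem integral_inv_pow_add_sideCoeff {α : ℝ} (hα : 1 < α) {a w : ℂ} (ha : 0 < a.re)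
    (hw : 0 < w.re) (k : ℕ) :
    ∫ θ : ℝ, ((w + sideCoeff a θ * ((|θ| ^ α : ℝ) : ℂ)) ^ (k + 1))⁻¹ =
      (k.factorial : ℂ)⁻¹ * Complex.Gamma ((1 / α + 1 : ℝ) : ℂ) *
        Complex.Gamma ((k + 1 - 1 / α : ℝ) : ℂ) *
        (a ^ (-((1 / α : ℝ) : ℂ)) + (starRingEnd ℂ a) ^ (-((1 / α : ℝ) : ℂ))) *
        w ^ (-((k + 1 - 1 / α : ℝ) : ℂ)) := by
  have hint := integrable_inv_pow_add_sideCoeff hα ha hw k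
  rw [← intervalIntegral.integral_Iic_add_Ioi (b := 0) hint.integrableOn hint.integrableOn]
  have h1 : ∫ θ in Set.Ioi (0 : ℝ), ((w + sideCoeff a θ * ((|θ| ^ α : ℝ) : ℂ)) ^ (k + 1))⁻¹ =
      ∫ θ in Set.Ioi (0 : ℝ), ((w + a * ((θ ^ α : ℝ) : ℂ)) ^ (k + 1))⁻¹ := by
    refine setIntegral_congr_fun measurableSet_Ioi fun θ hθ => ?_
    have : (0 : ℝ) < θ := hθ
    simp [sideCoeff, this, abs_of_pos this]
  have h2 : ∫ θ in Set.Iic (0 : ℝ), ((w + sideCoeff a θ * ((|θ| ^ α : ℝ) : ℂ)) ^ (k + 1))⁻¹ =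
      ∫ θ in Set.Ioi (0 : ℝ), ((w + starRingEnd ℂ a * ((θ ^ α : ℝ) : ℂ)) ^ (k + 1))⁻¹ := by
    rw [← neg_zero, ← integral_comp_neg_Ioi, neg_zero]
    refine setIntegral_congr_fun measurableSet_Ioi fun θ hθ => ?_
    have : (0 : ℝ) < θ := hθ
    simp [sideCoeff, this.not_gt, abs_of_pos this]
  rw [h1, h2, integral_inv_pow_add_mul_rpow hα hw ha,
    integral_inv_pow_add_mul_rpow hα hw (by simpa using ha)]
  ring

/-- Stated for differences because `u` and `v` need not converge: in the application they depend on
the direction `(1-s)/|1-s|`, which has no limit as `s → 1`. -/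
theorem tendsto_pow_sub_pow {ι : Type*} {l : Filter ι} {u v : ι → ℂ} {B : ℝ}
    (hu : ∀ᶠ i in l, ‖u i‖ ≤ B) (hv : ∀ᶠ i in l, ‖v i‖ ≤ B)
    (h : Tendsto (fun i => u i - v i) l (𝓝 0)) (m : ℕ) :
    Tendsto (fun i => u i ^ m - v i ^ m) l (𝓝 0) := by
  induction m with
  | zero => simpa using tendsto_const_nhds
  | succ m ih =>
    have h1 : Tendsto (fun i => (u i ^ m - v i ^ m) * u i) l (𝓝 0) :=
      ih.zero_mul_isBoundedUnder_le (isBoundedUnder_of_eventually_le hu)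
    have h2 : Tendsto (fun i => (u i - v i) * v i ^ m) l (𝓝 0) := by
      refine h.zero_mul_isBoundedUnder_le (isBoundedUnder_of_eventually_le (a := B ^ m) ?_)
      filter_upwards [hv] with i hi
      simp only [Function.comp, norm_pow]
      gcongr
    have h3 := h1.add h2
    rw [add_zero] at h3
    refine h3.congr fun i => ?_
    ring

/-! ### Asymptotics of the resolvent moments -/

/-- The integrals over a period of `φ ^ k / (1 - s φ) ^ (k + 1)`. -/
noncomputable def resolventMoment (φ : ℝ → ℂ) (k : ℕ) (s : ℂ) : ℂ :=
  ∫ θ in Set.Ioc (-Real.pi) Real.pi, φ θ ^ k * ((1 - s * φ θ) ^ (k + 1))⁻¹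

/-- The limit of the rescaled resolvent moments. -/
noncomputable def stableMoment (α : ℝ) (a : ℂ) (k : ℕ) : ℂ :=
  (k.factorial : ℂ)⁻¹ * Complex.Gamma ((1 / α + 1 : ℝ) : ℂ) *
    Complex.Gamma ((k + 1 - 1 / α : ℝ) : ℂ) *
    (a ^ (-((1 / α : ℝ) : ℂ)) + (starRingEnd ℂ a) ^ (-((1 / α : ℝ) : ℂ)))

theorem one_sub_ne_zero_of_mem_ball {s : ℂ} (hs : s ∈ Metric.ball (0 : ℂ) 1) : 1 - s ≠ 0 := by
  intro h
  rw [sub_eq_zero] at h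
  simp [← h] at hs

theorem one_sub_re_pos {s : ℂ} (hs : s ∈ Metric.ball (0 : ℂ) 1) : 0 < (1 - s).re := by
  have h1 : ‖s‖ < 1 := by simpa using hs
  have := (Complex.re_le_norm s).trans_lt h1
  simpa using this

theorem abs_scale_rpow {α r : ℝ} (hα : 0 < α) (hr : 0 ≤ r) (x : ℝ) :
    |r ^ (1 / α) * x| ^ α = r * |x| ^ α := by
  rw [abs_mul, abs_of_nonneg (by positivity), Real.mul_rpow (by positivity) (abs_nonneg _),
    ← Real.rpow_mul hr, one_div_mul_cancel hα.ne', Real.rpow_one]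

namespace IsStableSymbol

variable {φ : ℝ → ℂ} {α : ℝ} {a : ℂ}

theorem one_sub_mul_ne_zero (h : IsStableSymbol φ α a) {s : ℂ} (hs : s ∈ Metric.ball (0 : ℂ) 1)
    (θ : ℝ) : 1 - s * φ θ ≠ 0 := by
  intro h0
  have h1 : ‖s‖ < 1 := by simpa using hs
  have h2 : ‖s * φ θ‖ = 1 := by rw [← sub_eq_zero.1 h0, norm_one]
  rw [norm_mul] at h2
  nlinarith [h.norm_le_one θ, norm_nonneg s, norm_nonneg (φ θ)]

theorem continuous_resolvent (h : IsStableSymbol φ α a) {s : ℂ}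
    (hs : s ∈ Metric.ball (0 : ℂ) 1) (k : ℕ) :
    Continuous fun θ => φ θ ^ k * ((1 - s * φ θ) ^ (k + 1))⁻¹ := by
  have hc := h.continuous
  refine (hc.pow k).mul (Continuous.inv₀ (by fun_prop) fun θ => ?_)
  exact pow_ne_zero _ (h.one_sub_mul_ne_zero hs θ)

/-- The rescaled symbol converges. -/
theorem tendsto_scaled_symbol (h : IsStableSymbol φ α a) {x : ℝ} (hx : x ≠ 0) :
    Tendsto (fun s : ℂ => (1 - s * φ (‖1 - s‖ ^ (1 / α) * x)) / (‖1 - s‖ : ℂ) -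
      ((1 - s) / (‖1 - s‖ : ℂ) + sideCoeff a x * ((|x| ^ α : ℝ) : ℂ)))
      (𝓝[Metric.ball 0 1] 1) (𝓝 0) := by
  have hα0 : 0 < α := by have := h.one_lt; linarith
  have hε : Tendsto (fun s : ℂ => ‖1 - s‖ ^ (1 / α) * x) (𝓝[Metric.ball 0 1] 1) (𝓝[≠] 0) := by
    refine tendsto_nhdsWithin_iff.2 ⟨?_, ?_⟩
    · have h1 : Continuous fun s : ℂ => ‖1 - s‖ ^ (1 / α) * x :=
        ((continuous_const.sub continuous_id).norm.rpow_const
          fun _ => Or.inr (by positivity)).mul_const x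
      have h2 := h1.tendsto 1
      rw [sub_self, norm_zero, Real.zero_rpow (by positivity), zero_mul] at h2
      exact h2.mono_left nhdsWithin_le_nhds
    · filter_upwards [self_mem_nhdsWithin] with s hs
      have : 0 < ‖1 - s‖ := norm_pos_iff.2 (one_sub_ne_zero_of_mem_ball hs)
      exact mul_ne_zero (by positivity) hx
  have hs1 : Tendsto (fun s : ℂ => s) (𝓝[Metric.ball 0 1] 1) (𝓝 1) :=
    tendsto_id.mono_left nhdsWithin_le_nhds
  -- With `q = (1-φ)/|θ|^α` at the rescaled point and `σ` the side coefficient, the difference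
  -- equals `(s (q - σ) + (s - 1) σ) |x|^α`.
  have h1 := ((hs1.mul (h.tendsto_sub_sideCoeff.comp hε)).add
    ((hs1.sub_const 1).mul_const (sideCoeff a x))).mul_const ((|x| ^ α : ℝ) : ℂ)
  simp only [mul_zero, sub_self, zero_mul, add_zero] at h1
  refine h1.congr' ?_
  filter_upwards [self_mem_nhdsWithin] with s hs
  have hn : 0 < ‖1 - s‖ := norm_pos_iff.2 (one_sub_ne_zero_of_mem_ball hs)
  have hT : 0 < |x| ^ α := Real.rpow_pos_of_pos (abs_pos.2 hx) _
  have h2 := abs_scale_rpow hα0 hn.le x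
  simp only [Function.comp]
  rw [h2, sideCoeff_mul a (by positivity)]
  have hnC : (‖1 - s‖ : ℂ) ≠ 0 := by exact_mod_cast hn.ne'
  have hTC : ((|x| ^ α : ℝ) : ℂ) ≠ 0 := by exact_mod_cast hT.ne'
  rw [Complex.ofReal_mul]
  field_simp
  ring

/-- The resolvent moments are asymptotic to their stable counterparts. -/
theorem tendsto_scaled_resolventMoment_sub (h : IsStableSymbol φ α a) (k : ℕ) :
    Tendsto (fun s : ℂ => ((‖1 - s‖ ^ ((k : ℝ) + 1 - 1 / α) : ℝ) : ℂ) * (resolventMoment φ k s -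
      ∫ θ : ℝ, ((1 - s + sideCoeff a θ * ((|θ| ^ α : ℝ) : ℂ)) ^ (k + 1))⁻¹))
      (𝓝[Metric.ball 0 1] 1) (𝓝 0) := by
  have hα0 : 0 < α := by have := h.one_lt; linarith
  obtain ⟨c, hc, hle⟩ := h.exists_le_norm_one_sub_mul
  obtain ⟨c', hc', hle'⟩ := exists_le_norm_add_sideCoeff_mul h.re_pos
  set I : Set ℝ := Set.Ioc (-Real.pi) Real.pi with hI
  set D : ℂ → ℝ → ℂ := fun s x => (1 - s * φ (‖1 - s‖ ^ (1 / α) * x)) / (‖1 - s‖ : ℂ) with hD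
  set E : ℂ → ℝ → ℂ := fun s x =>
    (1 - s) / (‖1 - s‖ : ℂ) + sideCoeff a x * ((|x| ^ α : ℝ) : ℂ) with hE
  -- After `θ = |1-s|^(1/α) x` the true and model integrands are subtracted before passing to the
  -- limit: each alone keeps the oscillating direction `(1-s)/|1-s|`, and only the difference tends
  -- to `0`.
  set F : ℂ → ℝ → ℂ := fun s x => I.indicator (fun _ => φ (‖1 - s‖ ^ (1 / α) * x) ^ k *
    (D s x ^ (k + 1))⁻¹) (‖1 - s‖ ^ (1 / α) * x) - (E s x ^ (k + 1))⁻¹ with hF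
  have hn : ∀ s ∈ Metric.ball (0 : ℂ) 1, 0 < ‖1 - s‖ := fun s hs =>
    norm_pos_iff.2 (one_sub_ne_zero_of_mem_ball hs)
  have hTscale : ∀ s ∈ Metric.ball (0 : ℂ) 1, ∀ x : ℝ,
      |‖1 - s‖ ^ (1 / α) * x| ^ α = ‖1 - s‖ * |x| ^ α := by
    intro s hs x
    exact abs_scale_rpow hα0 (hn s hs).le x
  have hDle : ∀ s ∈ Metric.ball (0 : ℂ) 1, ∀ x : ℝ, ‖1 - s‖ ^ (1 / α) * x ∈ I →
      c * (1 + |x| ^ α) ≤ ‖D s x‖ := by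
    intro s hs x hx
    have h0 := hn s hs
    have h1 := hle s (by simpa using (Metric.mem_ball.1 hs).le) _ (abs_le.2 ⟨hx.1.le, hx.2⟩)
    rw [hTscale s hs] at h1
    simp only [hD]
    rw [norm_div, Complex.norm_real, norm_norm, le_div_iff₀ h0]
    linarith
  have hEle : ∀ s ∈ Metric.ball (0 : ℂ) 1, ∀ x : ℝ, c' * (1 + |x| ^ α) ≤ ‖E s x‖ := by
    intro s hs x
    have h0 := hn s hs
    have h1 := hle' ((1 - s) / (‖1 - s‖ : ℂ))
      (by rw [Complex.div_ofReal_re]; exact div_nonneg (one_sub_re_pos hs).le h0.le) x (|x| ^ α)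
      (by positivity)
    rwa [norm_div, Complex.norm_real, norm_norm, div_self h0.ne'] at h1
  have hinv : ∀ (m : ℝ) (z : ℂ) (x : ℝ), 0 < m → m * (1 + |x| ^ α) ≤ ‖z‖ →
      ‖(z ^ (k + 1))⁻¹‖ ≤ (m ^ (k + 1))⁻¹ * (1 + |x| ^ α)⁻¹ := by
    intro m z x hm hz
    have hT : 0 ≤ |x| ^ α := by positivity
    rw [norm_inv, norm_pow]
    calc (‖z‖ ^ (k + 1))⁻¹ ≤ ((m * (1 + |x| ^ α)) ^ (k + 1))⁻¹ := by gcongr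
      _ = (m ^ (k + 1))⁻¹ * ((1 + |x| ^ α) ^ (k + 1))⁻¹ := by rw [mul_pow, mul_inv]
      _ ≤ _ := by
        gcongr
        exact le_self_pow₀ (by linarith) (by omega)
  have hscale : ∀ s ∈ Metric.ball (0 : ℂ) 1, (∫ x, F s x) =
      ((‖1 - s‖ ^ ((k : ℝ) + 1 - 1 / α) : ℝ) : ℂ) * (resolventMoment φ k s -
      ∫ θ : ℝ, ((1 - s + sideCoeff a θ * ((|θ| ^ α : ℝ) : ℂ)) ^ (k + 1))⁻¹) := by
    intro s hs
    have h0 := hn s hs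
    have h0C : (‖1 - s‖ : ℂ) ≠ 0 := by exact_mod_cast h0.ne'
    have hε : 0 < ‖1 - s‖ ^ (1 / α) := by positivity
    set G : ℝ → ℂ := fun θ => I.indicator (fun θ => φ θ ^ k * ((1 - s * φ θ) ^ (k + 1))⁻¹) θ -
      ((1 - s + sideCoeff a θ * ((|θ| ^ α : ℝ) : ℂ)) ^ (k + 1))⁻¹ with hG
    have h1 : ∀ x, F s x = (‖1 - s‖ : ℂ) ^ (k + 1) * G (‖1 - s‖ ^ (1 / α) * x) := by
      intro x
      simp only [hF, hG, hD, hE]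
      rw [hTscale s hs, sideCoeff_mul a hε, mul_sub]
      congr 1
      · by_cases hx : ‖1 - s‖ ^ (1 / α) * x ∈ I
        · rw [Set.indicator_of_mem hx, Set.indicator_of_mem hx, div_pow, inv_div]
          ring
        · rw [Set.indicator_of_notMem hx, Set.indicator_of_notMem hx, mul_zero]
      · have h2 : 1 - s + sideCoeff a x * ((‖1 - s‖ * |x| ^ α : ℝ) : ℂ) =
            ‖1 - s‖ * ((1 - s) / (‖1 - s‖ : ℂ) + sideCoeff a x * ((|x| ^ α : ℝ) : ℂ)) := by
          rw [Complex.ofReal_mul]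
          field_simp
        rw [h2, mul_pow, mul_inv, ← mul_assoc, mul_inv_cancel₀ (pow_ne_zero _ h0C), one_mul]
    simp_rw [h1]
    rw [integral_const_mul, Measure.integral_comp_mul_left G, abs_of_pos (by positivity),
      Complex.real_smul, ← mul_assoc]
    congr 1
    · rw [show (k : ℝ) + 1 - 1 / α = ((k + 1 : ℕ) : ℝ) - 1 / α by push_cast; ring,
        Real.rpow_sub h0, Real.rpow_natCast]
      push_cast
      exact (div_eq_mul_inv _ _).symm
    · rw [integral_sub, integral_indicator measurableSet_Ioc]
      · rfl
      · rw [integrable_indicator_iff measurableSet_Ioc]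
        exact ((h.continuous_resolvent hs k).integrableOn_Icc).mono_set Set.Ioc_subset_Icc_self
      · exact integrable_inv_pow_add_sideCoeff h.one_lt h.re_pos (one_sub_re_pos hs) k
  refine Tendsto.congr' (f₁ := fun s => ∫ x, F s x) ?_ ?_
  · filter_upwards [self_mem_nhdsWithin] with s hs
    exact hscale s hs
  suffices hmain : Tendsto (fun s => ∫ x, F s x) (𝓝[Metric.ball 0 1] 1)
      (𝓝 (∫ _ : ℝ, (0 : ℂ))) by simpa using hmain
  refine tendsto_integral_filter_of_dominated_convergence
    (fun x => ((c ^ (k + 1))⁻¹ + (c' ^ (k + 1))⁻¹) * (1 + |x| ^ α)⁻¹) ?_ ?_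
    ((integrable_inv_one_add_abs_rpow h.one_lt).const_mul _) ?_
  · refine Eventually.of_forall fun s => Measurable.aestronglyMeasurable ?_
    have hφ := h.continuous.measurable
    have hsc := measurable_sideCoeff a
    refine Measurable.sub ?_ (by fun_prop)
    have h1 : Measurable fun x => φ (‖1 - s‖ ^ (1 / α) * x) ^ k * (D s x ^ (k + 1))⁻¹ := by
      fun_prop
    have h2 : MeasurableSet {x : ℝ | ‖1 - s‖ ^ (1 / α) * x ∈ I} :=
      measurableSet_Ioc.preimage (measurable_const_mul _)
    exact h1.indicator h2
  · filter_upwards [self_mem_nhdsWithin] with s hs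
    refine Eventually.of_forall fun x => ?_
    rw [add_mul]
    refine (norm_sub_le _ _).trans (add_le_add ?_ (hinv _ _ _ hc' (hEle s hs x)))
    by_cases hx : ‖1 - s‖ ^ (1 / α) * x ∈ I
    · rw [Set.indicator_of_mem hx, norm_mul, norm_pow]
      calc _ ≤ 1 * ((c ^ (k + 1))⁻¹ * (1 + |x| ^ α)⁻¹) := by
            refine mul_le_mul ?_ (hinv _ _ _ hc (hDle s hs x hx)) (norm_nonneg _) zero_le_one
            exact pow_le_one₀ (norm_nonneg _) (h.norm_le_one _)
        _ = _ := one_mul _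
    · rw [Set.indicator_of_notMem hx, norm_zero]
      positivity
  · have hae : ∀ᵐ x : ℝ, x ≠ 0 := by
      rw [ae_iff]; simp
    filter_upwards [hae] with x hx
    have hlim := h.tendsto_scaled_symbol hx
    have hT : 0 ≤ |x| ^ α := by positivity
    have hε : Tendsto (fun s : ℂ => ‖1 - s‖ ^ (1 / α) * x) (𝓝[Metric.ball 0 1] 1) (𝓝 0) := by
      have h1 : Continuous fun s : ℂ => ‖1 - s‖ ^ (1 / α) * x :=
        ((continuous_const.sub continuous_id).norm.rpow_const
          fun _ => Or.inr (by positivity)).mul_const x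
      have h2 := h1.tendsto 1
      rw [sub_self, norm_zero, Real.zero_rpow (by positivity), zero_mul] at h2
      exact h2.mono_left nhdsWithin_le_nhds
    have hmem : ∀ᶠ s in 𝓝[Metric.ball (0 : ℂ) 1] 1, ‖1 - s‖ ^ (1 / α) * x ∈ I :=
      hε.eventually (Ioc_mem_nhds (by linarith [Real.pi_pos]) Real.pi_pos)
    have hDb : ∀ᶠ s in 𝓝[Metric.ball (0 : ℂ) 1] 1, ‖(D s x)⁻¹‖ ≤ c⁻¹ + c'⁻¹ := by
      filter_upwards [hmem, self_mem_nhdsWithin] with s hs hs'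
      rw [norm_inv]
      have h1 : c ≤ ‖D s x‖ := le_trans (by nlinarith) (hDle s hs' x hs)
      have h2 : ‖D s x‖⁻¹ ≤ c⁻¹ := by gcongr
      have h3 : 0 < c'⁻¹ := by positivity
      linarith
    have hEb : ∀ᶠ s in 𝓝[Metric.ball (0 : ℂ) 1] 1, ‖(E s x)⁻¹‖ ≤ c⁻¹ + c'⁻¹ := by
      filter_upwards [self_mem_nhdsWithin] with s hs'
      rw [norm_inv]
      have h1 : c' ≤ ‖E s x‖ := le_trans (by nlinarith) (hEle s hs' x)
      have h2 : ‖E s x‖⁻¹ ≤ c'⁻¹ := by gcongr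
      have h3 : 0 < c⁻¹ := by positivity
      linarith
    have hinvlim : Tendsto (fun s => (D s x)⁻¹ - (E s x)⁻¹) (𝓝[Metric.ball 0 1] 1) (𝓝 0) := by
      have h1 := (hlim.zero_mul_isBoundedUnder_le (isBoundedUnder_of_eventually_le hDb)
        ).zero_mul_isBoundedUnder_le (isBoundedUnder_of_eventually_le hEb)
      have h2 := h1.neg
      rw [neg_zero] at h2
      refine h2.congr' ?_
      filter_upwards [hmem, self_mem_nhdsWithin] with s hs hs'
      have h3 : D s x ≠ 0 := by
        have := hDle s hs' x hs
        exact norm_pos_iff.1 (lt_of_lt_of_le (by positivity) this)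
      have h4 : E s x ≠ 0 := by
        have := hEle s hs' x
        exact norm_pos_iff.1 (lt_of_lt_of_le (by positivity) this)
      -- `1/D - 1/E = -(D - E)/(DE)`, with both inverses bounded by the kernel estimates.
      change -((D s x - E s x) * (D s x)⁻¹ * (E s x)⁻¹) = _
      field_simp
      ring
    have hpow := tendsto_pow_sub_pow hDb hEb hinvlim (k + 1)
    have hφ : Tendsto (fun s : ℂ => φ (‖1 - s‖ ^ (1 / α) * x) ^ k - 1)
        (𝓝[Metric.ball 0 1] 1) (𝓝 0) := by
      have h1 := (((h.continuous.tendsto 0).comp hε).pow k).sub_const 1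
      rw [h.map_zero, one_pow, sub_self] at h1
      exact h1
    have hmul : Tendsto (fun s : ℂ => (φ (‖1 - s‖ ^ (1 / α) * x) ^ k - 1) * (D s x)⁻¹ ^ (k + 1))
        (𝓝[Metric.ball 0 1] 1) (𝓝 0) := by
      refine hφ.zero_mul_isBoundedUnder_le
        (isBoundedUnder_of_eventually_le (a := (c⁻¹ + c'⁻¹) ^ (k + 1)) ?_)
      filter_upwards [hDb] with s hs
      simp only [Function.comp, norm_pow]
      gcongr
    have hsum := hmul.add hpow
    rw [add_zero] at hsum
    refine hsum.congr' ?_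
    filter_upwards [hmem] with s hs
    simp only [hF]
    rw [Set.indicator_of_mem hs, inv_pow, inv_pow]
    ring

/-- The model integral is exactly `M_k (1-s)^(-(k+1-1/α))`. Since the exponent is real, `(1-s)^p`
and `|1-s|^p` have the same modulus, so the comparison in absolute value suffices. -/
theorem tendsto_scaled_resolventMoment (h : IsStableSymbol φ α a) (k : ℕ) :
    Tendsto (fun s : ℂ => (1 - s) ^ (((k : ℝ) + 1 - 1 / α : ℝ) : ℂ) * resolventMoment φ k s)
      (𝓝[Metric.ball 0 1] 1) (𝓝 (stableMoment α a k)) := by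
  rw [← tendsto_sub_nhds_zero_iff, tendsto_zero_iff_norm_tendsto_zero]
  have h1 := (h.tendsto_scaled_resolventMoment_sub k).norm
  rw [norm_zero] at h1
  refine h1.congr' ?_
  filter_upwards [self_mem_nhdsWithin] with s hs
  have hne := one_sub_ne_zero_of_mem_ball hs
  rw [integral_inv_pow_add_sideCoeff h.one_lt h.re_pos (one_sub_re_pos hs) k, norm_mul,
    Complex.norm_real, Real.norm_of_nonneg (by positivity), ← Complex.norm_cpow_real, ← norm_mul,
    mul_sub, Complex.cpow_neg (1 - s)]
  congr 2
  have h2 : (1 - s) ^ (((k : ℝ) + 1 - 1 / α : ℝ) : ℂ) ≠ 0 := by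
    simp only [ne_eq, Complex.cpow_eq_zero_iff, hne, false_and, not_false_eq_true]
  rw [mul_comm, mul_assoc, inv_mul_cancel₀ h2, mul_one, stableMoment]

end IsStableSymbol

/-! ### Derivatives, bounds and power series of the resolvent moments -/

namespace IsStableSymbol

variable {φ : ℝ → ℂ} {α : ℝ} {a : ℂ}

/-- Differentiation under the integral sign, dominated on the disc of radius `r = (1+‖s‖)/2`, where
the kernel is at least `1 - r`. -/
theorem hasDerivAt_resolventMoment (h : IsStableSymbol φ α a) {s : ℂ}
    (hs : s ∈ Metric.ball (0 : ℂ) 1) (k : ℕ) :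
    HasDerivAt (resolventMoment φ k) (((k : ℂ) + 1) * resolventMoment φ (k + 1) s) s := by
  have hs1 : ‖s‖ < 1 := by simpa using hs
  set r := (1 + ‖s‖) / 2 with hr
  have hr1 : r < 1 := by linarith
  have hrball : Metric.ball (0 : ℂ) r ⊆ Metric.ball 0 1 := Metric.ball_subset_ball hr1.le
  have hnhds : Metric.ball (0 : ℂ) r ∈ 𝓝 s :=
    Metric.isOpen_ball.mem_nhds (by simp [hr]; linarith)
  have hmeas : ∀ k, ∀ z ∈ Metric.ball (0 : ℂ) 1, AEStronglyMeasurable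
      (fun θ => φ θ ^ k * ((1 - z * φ θ) ^ (k + 1))⁻¹)
      (volume.restrict (Set.Ioc (-Real.pi) Real.pi)) := fun k z hz =>
    (h.continuous_resolvent hz k).aestronglyMeasurable
  have key := (hasDerivAt_integral_of_dominated_loc_of_deriv_le (𝕜 := ℂ)
    (μ := volume.restrict (Set.Ioc (-Real.pi) Real.pi)) hnhds
    (F := fun z θ => φ θ ^ k * ((1 - z * φ θ) ^ (k + 1))⁻¹)
    (F' := fun z θ => ((k : ℂ) + 1) * (φ θ ^ (k + 1) * ((1 - z * φ θ) ^ (k + 1 + 1))⁻¹))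
    (bound := fun _ => ((k : ℝ) + 1) * ((1 - r) ^ (k + 1 + 1))⁻¹) (x₀ := s) ?_
    ?_ ?_ ?_ ?_ ?_).2
  · rw [integral_const_mul] at key
    exact key
  · filter_upwards [hnhds] with z hz
    exact hmeas k z (hrball hz)
  · exact ((h.continuous_resolvent hs k).integrableOn_Icc).mono_set Set.Ioc_subset_Icc_self
  · exact (hmeas (k + 1) s hs).const_mul _
  · refine Eventually.of_forall fun θ z hz => ?_
    have hz' : ‖z‖ < r := by simpa using hz
    have h1 : 1 - r ≤ ‖1 - z * φ θ‖ := by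
      have h2 := norm_sub_norm_le 1 (z * φ θ)
      rw [norm_one, norm_mul] at h2
      have h3 : ‖z‖ * ‖φ θ‖ ≤ r * 1 :=
        mul_le_mul hz'.le (h.norm_le_one θ) (norm_nonneg _) (by linarith [norm_nonneg z])
      linarith
    rw [norm_mul, norm_mul, norm_inv, norm_pow, norm_pow]
    have h4 : ‖(k : ℂ) + 1‖ = (k : ℝ) + 1 := by
      rw [← Nat.cast_succ, Complex.norm_natCast]; push_cast; rfl
    rw [h4]
    have h5 : ‖φ θ‖ ^ (k + 1) ≤ 1 := pow_le_one₀ (norm_nonneg _) (h.norm_le_one θ)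
    have h6 : 0 < 1 - r := by linarith
    have h7 : (‖1 - z * φ θ‖ ^ (k + 1 + 1))⁻¹ ≤ ((1 - r) ^ (k + 1 + 1))⁻¹ := by gcongr
    refine mul_le_mul_of_nonneg_left ?_ (by positivity)
    calc _ ≤ 1 * ((1 - r) ^ (k + 1 + 1))⁻¹ := mul_le_mul h5 h7 (by positivity) zero_le_one
      _ = _ := one_mul _
  · exact integrable_const _
  · refine Eventually.of_forall fun θ z hz => ?_
    have hne := h.one_sub_mul_ne_zero (hrball hz) θ
    have h1 : HasDerivAt (fun z : ℂ => 1 - z * φ θ) (-(1 * φ θ)) z :=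
      ((hasDerivAt_id z).mul_const _).const_sub 1
    refine (((h1.fun_pow (k + 1)).fun_inv (pow_ne_zero _ hne)).const_mul (φ θ ^ k)).congr_deriv ?_
    push_cast
    field_simp
    ring

/-- The uniform kernel bound up to the unit circle leaves `s = 1` as the only singularity, as the
coefficient transfer requires. -/
theorem norm_resolventMoment_le (h : IsStableSymbol φ α a) (k : ℕ) {δ : ℝ} (hδ : 0 < δ) :
    ∃ K, ∀ s ∈ Metric.ball (0 : ℂ) 1, δ ≤ ‖1 - s‖ → ‖resolventMoment φ k s‖ ≤ K := by
  obtain ⟨c, hc, hle⟩ := h.exists_le_norm_one_sub_mul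
  refine ⟨((c * δ) ^ (k + 1))⁻¹ * volume.real (Set.Ioc (-Real.pi) Real.pi), fun s hs hsδ => ?_⟩
  refine norm_setIntegral_le_of_norm_le_const (by simp) fun θ hθ => ?_
  have h1 := hle s (by simpa using (Metric.mem_ball.1 hs).le) θ (abs_le.2 ⟨hθ.1.le, hθ.2⟩)
  have h2 : c * δ ≤ ‖1 - s * φ θ‖ := by
    refine le_trans (mul_le_mul_of_nonneg_left ?_ hc.le) h1
    have : 0 ≤ |θ| ^ α := by positivity
    linarith
  rw [norm_mul, norm_inv, norm_pow, norm_pow]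
  have h5 : ‖φ θ‖ ^ k ≤ 1 := pow_le_one₀ (norm_nonneg _) (h.norm_le_one θ)
  have h7 : (‖1 - s * φ θ‖ ^ (k + 1))⁻¹ ≤ ((c * δ) ^ (k + 1))⁻¹ := by gcongr
  calc _ ≤ 1 * ((c * δ) ^ (k + 1))⁻¹ := mul_le_mul h5 h7 (by positivity) zero_le_one
    _ = _ := one_mul _

theorem hasSum_resolventMoment_zero (h : IsStableSymbol φ α a) {s : ℂ}
    (hs : s ∈ Metric.ball (0 : ℂ) 1) :
    HasSum (fun n : ℕ => (∫ θ in Set.Ioc (-Real.pi) Real.pi, φ θ ^ n) * s ^ n)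
      (resolventMoment φ 0 s) := by
  have hs1 : ‖s‖ < 1 := by simpa using hs
  have hint : ∀ n : ℕ, IntegrableOn (fun θ => φ θ ^ n * s ^ n)
      (Set.Ioc (-Real.pi) Real.pi) := fun n =>
    (((h.continuous.pow n).mul continuous_const).integrableOn_Icc).mono_set
      Set.Ioc_subset_Icc_self
  have hle : ∀ n : ℕ, ∫ θ in Set.Ioc (-Real.pi) Real.pi, ‖φ θ ^ n * s ^ n‖ ≤
      volume.real (Set.Ioc (-Real.pi) Real.pi) * ‖s‖ ^ n := by
    intro n
    have h1 : ∫ θ in Set.Ioc (-Real.pi) Real.pi, ‖φ θ ^ n * s ^ n‖ ≤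
        ∫ θ in Set.Ioc (-Real.pi) Real.pi, ‖s‖ ^ n := by
      refine integral_mono (hint n).norm (integrableOn_const (by simp) (by simp)) fun θ => ?_
      simp only [norm_mul, norm_pow]
      have : ‖φ θ‖ ^ n ≤ 1 := pow_le_one₀ (norm_nonneg _) (h.norm_le_one θ)
      calc _ ≤ 1 * ‖s‖ ^ n := by gcongr
        _ = _ := one_mul _
    simpa using h1
  have key := hasSum_integral_of_summable_integral_norm hint
    (Summable.of_nonneg_of_le (fun n => integral_nonneg fun _ => norm_nonneg _) hle
      ((summable_geometric_of_lt_one (norm_nonneg s) hs1).mul_left _))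
  simp_rw [integral_mul_const] at key
  have hR : resolventMoment φ 0 s =
      ∫ θ in Set.Ioc (-Real.pi) Real.pi, ∑' n : ℕ, φ θ ^ n * s ^ n := by
    refine setIntegral_congr_fun measurableSet_Ioc fun θ _ => ?_
    have h1 : ‖s * φ θ‖ < 1 := by
      rw [norm_mul]
      calc ‖s‖ * ‖φ θ‖ ≤ ‖s‖ * 1 := by gcongr; exact h.norm_le_one θ
        _ < 1 := by rwa [mul_one]
    have h2 := tsum_geometric_of_norm_lt_one h1
    simp only [pow_zero, one_mul, zero_add, pow_one]
    rw [← h2]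
    refine tsum_congr fun n => ?_
    rw [mul_pow, mul_comm]
  rw [hR]
  exact key

end IsStableSymbol

/-! ### Generating functions and the renewal equation -/

/-- The generating function of a real sequence. -/
noncomputable def genFun (f : ℕ → ℝ) (s : ℂ) : ℂ := ∑' n, (f n : ℂ) * s ^ n

theorem summable_norm_genFun {f : ℕ → ℝ} (hf : ∀ n, |f n| ≤ 1) {s : ℂ}
    (hs : s ∈ Metric.ball (0 : ℂ) 1) : Summable fun n => ‖(f n : ℂ) * s ^ n‖ := by
  have hs1 : ‖s‖ < 1 := by simpa using hs
  refine Summable.of_nonneg_of_le (fun n => norm_nonneg _) (fun n => ?_)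
    (summable_geometric_of_lt_one (norm_nonneg s) hs1)
  rw [norm_mul, norm_pow, Complex.norm_real, Real.norm_eq_abs]
  calc _ ≤ 1 * ‖s‖ ^ n := by gcongr; exact hf n
    _ = _ := one_mul _

theorem hasFPowerSeriesOnBall_genFun {f : ℕ → ℝ} (hf : ∀ n, |f n| ≤ 1) :
    HasFPowerSeriesOnBall (genFun f)
      (FormalMultilinearSeries.ofScalars ℂ fun n => (f n : ℂ)) 0 1 where
  r_le := by
    have := FormalMultilinearSeries.le_radius_of_bound
      (FormalMultilinearSeries.ofScalars ℂ fun n => (f n : ℂ)) 1 (r := 1) (fun n => by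
        rw [FormalMultilinearSeries.ofScalars_norm]
        simpa using hf n)
    simpa using this
  r_pos := one_pos
  hasSum := by
    intro y hy
    have hy' : y ∈ Metric.ball (0 : ℂ) 1 := by
      rw [← ENNReal.ofReal_one, Metric.eball_ofReal] at hy
      exact hy
    rw [zero_add]
    refine (summable_norm_genFun hf hy').of_norm.hasSum.congr_fun ?_
    intro n
    simp [mul_comm]

theorem iteratedDeriv_genFun {f : ℕ → ℝ} (hf : ∀ n, |f n| ≤ 1) (n : ℕ) :
    iteratedDeriv n (genFun f) 0 = n.factorial * f n := by
  have hps := hasFPowerSeriesOnBall_genFun hf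
  have h := hps.analyticAt.hasFPowerSeriesAt.eq_formalMultilinearSeries hps.hasFPowerSeriesAt
  have h := congrFun ((FormalMultilinearSeries.ofScalars_series_eq_iff _ _ _).1 h) n
  have hfac : (n.factorial : ℂ) ≠ 0 := by exact_mod_cast n.factorial_ne_zero
  rw [← h]
  field_simp

/-- The Cauchy product `F U` reproduces every coefficient of `U` except the one at `n = 0`, where it
is `f 0 * u 0 = 0` instead of `1`. -/
theorem genFun_mul_one_sub_of_renewal {f u : ℕ → ℝ} (hf : ∀ n, |f n| ≤ 1) (hu : ∀ n, |u n| ≤ 1)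
    (hu0 : u 0 = 1) (hf0 : f 0 = 0)
    (hren : ∀ n, n ≠ 0 → u n = ∑ p ∈ Finset.HasAntidiagonal.antidiagonal n, f p.1 * u p.2) {s : ℂ}
    (hs : s ∈ Metric.ball (0 : ℂ) 1) : genFun u s * (1 - genFun f s) = 1 := by
  have hsf := summable_norm_genFun hf hs
  have hsu := summable_norm_genFun hu hs
  have h1 : genFun f s * genFun u s = genFun u s - 1 := by
    unfold genFun
    rw [tsum_mul_tsum_eq_tsum_sum_antidiagonal_of_summable_norm hsf hsu]
    have h2 := hsu.of_norm.tsum_eq_zero_add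
    rw [h2]
    have h3 := (summable_norm_sum_mul_antidiagonal_of_summable_norm hsf hsu).of_norm
    rw [h3.tsum_eq_zero_add]
    simp only [Finset.Nat.antidiagonal_zero, Finset.sum_singleton, hf0, hu0, pow_zero,
      Complex.ofReal_zero, Complex.ofReal_one, mul_one, zero_add, add_sub_cancel_left]
    refine tsum_congr fun n => ?_
    rw [hren (n + 1) (by omega)]
    push_cast
    rw [Finset.sum_mul]
    refine Finset.sum_congr rfl fun p hp => ?_
    rw [← Finset.HasAntidiagonal.mem_antidiagonal.1 hp, pow_add]
    ring
  linear_combination -h1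

theorem norm_genFun_le_one {f : ℕ → ℝ} (hf : ∀ n, 0 ≤ f n)
    (hsum : ∀ n, ∑ i ∈ Finset.range n, f i ≤ 1) {s : ℂ} (hs : s ∈ Metric.ball (0 : ℂ) 1) :
    ‖genFun f s‖ ≤ 1 := by
  have hs1 : ‖s‖ < 1 := by simpa using hs
  have hsm : Summable f := summable_of_sum_range_le hf hsum
  have hle : ∀ n, ‖(f n : ℂ) * s ^ n‖ ≤ f n := by
    intro n
    rw [norm_mul, norm_pow, Complex.norm_real, Real.norm_of_nonneg (hf n)]
    calc _ ≤ f n * 1 := by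
          gcongr
          · exact hf n
          · exact pow_le_one₀ (norm_nonneg _) hs1.le
      _ = _ := mul_one _
  exact (tsum_of_norm_bounded hsm.hasSum hle).trans (Real.tsum_le_of_sum_range_le hf hsum)

/-- The coefficients of a second derivative are `(n+2)(n+1) f (n+2)`; this converts their
asymptotics back to `f`, the shift being harmless in the limit. -/
theorem tendsto_mul_rpow_of_shift {f : ℕ → ℝ} {β l : ℝ}
    (h : Tendsto (fun n : ℕ => f (n + 2) * ((n + 2) * (n + 1)) / (n : ℝ) ^ β) atTop (𝓝 l)) :
    Tendsto (fun n : ℕ => f n * (n : ℝ) ^ (2 - β)) atTop (𝓝 l) := by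
  rw [← tendsto_add_atTop_iff_nat 2]
  have hcast : Tendsto (fun n : ℕ => (n : ℝ)) atTop atTop := tendsto_natCast_atTop_atTop
  have h1 : Tendsto (fun n : ℕ => ((n : ℝ) + 2) / (n + 1)) atTop (𝓝 1) := by
    have h2 : Tendsto (fun n : ℕ => 1 + ((n : ℝ) + 1)⁻¹) atTop (𝓝 (1 + 0)) :=
      (tendsto_inv_atTop_zero.comp (tendsto_atTop_add_const_right _ 1 hcast)).const_add 1
    rw [add_zero] at h2
    refine h2.congr fun n => ?_
    field_simp
    ring
  have h2 : Tendsto (fun n : ℕ => ((n : ℝ) / (n + 2)) ^ β) atTop (𝓝 1) := by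
    have h3 : Tendsto (fun n : ℕ => (n : ℝ) / (n + 2)) atTop (𝓝 1) :=
      tendsto_natCast_div_add_atTop (2 : ℝ)
    have h4 := h3.rpow_const (p := β) (Or.inl one_ne_zero)
    rwa [Real.one_rpow] at h4
  have h3 := (h.mul h1).mul h2
  rw [mul_one, mul_one] at h3
  refine h3.congr' ?_
  filter_upwards [eventually_gt_atTop 0] with n hn
  have hn' : (0 : ℝ) < n := by exact_mod_cast hn
  rw [Real.div_rpow hn'.le (by positivity)]
  push_cast
  rw [Real.rpow_sub (by positivity), Real.rpow_two]
  have : 0 < (n : ℝ) ^ β := by positivity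
  have : 0 < ((n : ℝ) + 2) ^ β := by positivity
  field_simp

/-! ### Singularity of the second derivative and the first-return asymptotics -/

namespace IsStableSymbol

variable {φ : ℝ → ℂ} {α : ℝ} {a : ℂ}

theorem stableMoment_one (hα : 1 < α) :
    stableMoment α a 1 = ((1 - 1 / α : ℝ) : ℂ) * stableMoment α a 0 := by
  have hβ : 1 / α < 1 := by rw [div_lt_one (by linarith)]; exact hα
  have h1 : ((1 - 1 / α : ℝ) : ℂ) ≠ 0 := by exact_mod_cast (by linarith : (1 - 1 / α : ℝ) ≠ 0)
  have h2 := Complex.Gamma_add_one _ h1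
  rw [← Complex.ofReal_one, ← Complex.ofReal_add] at h2
  unfold stableMoment
  rw [show ((1 : ℕ) : ℝ) + 1 - 1 / α = 1 - 1 / α + 1 by push_cast; ring, h2]
  simp
  ring

theorem stableMoment_two (hα : 1 < α) :
    stableMoment α a 2 =
      ((2 - 1 / α : ℝ) : ℂ) * ((1 - 1 / α : ℝ) : ℂ) / 2 * stableMoment α a 0 := by
  have hβ : 1 / α < 1 := by rw [div_lt_one (by linarith)]; exact hα
  have h1 : ((2 - 1 / α : ℝ) : ℂ) ≠ 0 := by
    exact_mod_cast (by linarith : (2 - 1 / α : ℝ) ≠ 0)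
  have h2 := Complex.Gamma_add_one _ h1
  rw [← Complex.ofReal_one, ← Complex.ofReal_add] at h2
  have h3 := stableMoment_one (a := a) hα
  have h4 : stableMoment α a 2 = ((2 - 1 / α : ℝ) : ℂ) / 2 * stableMoment α a 1 := by
    unfold stableMoment
    rw [show ((2 : ℕ) : ℝ) + 1 - 1 / α = 2 - 1 / α + 1 by push_cast; ring, h2,
      show ((1 : ℕ) : ℝ) + 1 - 1 / α = 2 - 1 / α by push_cast; ring]
    simp
    ring
  rw [h4, h3]
  ring

/-- The singularity at `1` of the second derivative of the reciprocal of the zeroth resolvent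
moment. -/
theorem tendsto_scaled_secondDeriv (h : IsStableSymbol φ α a) (hm : stableMoment α a 0 ≠ 0) :
    Tendsto (fun s : ℂ => (1 - s) ^ ((1 / α + 1 : ℝ) : ℂ) *
      (2 * resolventMoment φ 2 s / resolventMoment φ 0 s ^ 2 -
        2 * resolventMoment φ 1 s ^ 2 / resolventMoment φ 0 s ^ 3)) (𝓝[Metric.ball 0 1] 1)
      (𝓝 (((1 / α * (1 - 1 / α) : ℝ) : ℂ) / stableMoment α a 0)) := by
  have t0 := h.tendsto_scaled_resolventMoment 0
  have t1 := h.tendsto_scaled_resolventMoment 1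
  have t2 := h.tendsto_scaled_resolventMoment 2
  have key := ((t2.const_mul 2).div (t0.pow 2) (pow_ne_zero 2 hm)).sub
    (((t1.pow 2).const_mul 2).div (t0.pow 3) (pow_ne_zero 3 hm))
  -- With `β = 1/α`, the functional equation of Gamma leaves `(1-β)((2-β) - 2(1-β)) = β(1-β)` over
  -- the zeroth moment.
  have hL : 2 * stableMoment α a 2 / stableMoment α a 0 ^ 2 -
      2 * stableMoment α a 1 ^ 2 / stableMoment α a 0 ^ 3 =
      ((1 / α * (1 - 1 / α) : ℝ) : ℂ) / stableMoment α a 0 := by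
    rw [stableMoment_two h.one_lt, stableMoment_one h.one_lt]
    push_cast
    generalize (1 / (α : ℂ)) = β
    field_simp
    ring
  rw [hL] at key
  refine key.congr' ?_
  filter_upwards [self_mem_nhdsWithin] with s hs
  have hw := one_sub_ne_zero_of_mem_ball hs
  set w := 1 - s with hw'
  -- All the powers are whole powers of `w` times powers of `P = w^(1-1/α)`, so the scaling factors
  -- combine to `w²/P`.
  set P := w ^ ((((0 : ℕ) : ℝ) + 1 - 1 / α : ℝ) : ℂ) with hP
  have hP0 : P ≠ 0 := by
    simp only [hP, ne_eq, Complex.cpow_eq_zero_iff, hw, false_and, not_false_eq_true]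
  have e1 : w ^ ((((1 : ℕ) : ℝ) + 1 - 1 / α : ℝ) : ℂ) = w * P := by
    rw [hP]
    nth_rewrite 2 [← Complex.cpow_one w]
    rw [← Complex.cpow_add _ _ hw]
    congr 1
    push_cast
    ring
  have e2 : w ^ ((((2 : ℕ) : ℝ) + 1 - 1 / α : ℝ) : ℂ) = w ^ 2 * P := by
    rw [hP, ← Complex.cpow_ofNat w 2, ← Complex.cpow_add _ _ hw]
    congr 1
    push_cast
    ring
  have e3 : w ^ ((1 / α + 1 : ℝ) : ℂ) = w ^ 2 / P := by
    rw [eq_div_iff hP0, hP, ← Complex.cpow_add _ _ hw, ← Complex.cpow_ofNat w 2]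
    congr 1
    push_cast
    ring
  simp only [Pi.div_apply, ← hw']
  rw [e1, e2, e3, ← hP]
  clear_value P
  -- No renewal structure is available here to exclude a zero; there both sides vanish because
  -- division by zero gives `0`.
  by_cases h0 : resolventMoment φ 0 s = 0
  · simp [h0]
  · field_simp

/-- First return probabilities of a renewal sequence whose terms are the integrals of the powers of
a stable symbol. -/
theorem tendsto_renewal (h : IsStableSymbol φ α a) (hm : stableMoment α a 0 ≠ 0) {f u : ℕ → ℝ}
    (hf : ∀ n, 0 ≤ f n) (hsum : ∀ n, ∑ i ∈ Finset.range n, f i ≤ 1) (hf0 : f 0 = 0)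
    (hu0 : u 0 = 1) (hu1 : ∀ n, |u n| ≤ 1)
    (hren : ∀ n, n ≠ 0 → u n = ∑ p ∈ Finset.HasAntidiagonal.antidiagonal n, f p.1 * u p.2)
    (hu : ∀ n, ∫ θ in Set.Ioc (-Real.pi) Real.pi, φ θ ^ n = 2 * Real.pi * u n) {κ : ℝ}
    (hκ : (κ : ℂ) = 2 * Real.pi * (((1 / α * (1 - 1 / α) : ℝ) : ℂ) / stableMoment α a 0) *
      (Complex.Gamma ((1 / α + 1 : ℝ) : ℂ))⁻¹) :
    Tendsto (fun n : ℕ => f n * (n : ℝ) ^ (2 - 1 / α)) atTop (𝓝 κ) := by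
  have hα0 : 0 < α := by have := h.one_lt; linarith
  have hpi : (2 * Real.pi : ℂ) ≠ 0 := by
    exact_mod_cast (by positivity : (2 * Real.pi : ℝ) ≠ 0)
  have hf1 : ∀ n, |f n| ≤ 1 := by
    intro n
    rw [abs_of_nonneg (hf n)]
    have := hsum (n + 1)
    rw [Finset.sum_range_succ] at this
    linarith [Finset.sum_nonneg fun i (_ : i ∈ Finset.range n) => hf i]
  have hR0 : ∀ s ∈ Metric.ball (0 : ℂ) 1, resolventMoment φ 0 s = 2 * Real.pi * genFun u s := by
    intro s hs
    rw [← (h.hasSum_resolventMoment_zero hs).tsum_eq, genFun, ← tsum_mul_left]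
    refine tsum_congr fun n => ?_
    rw [hu]
    ring
  have hprod : ∀ s ∈ Metric.ball (0 : ℂ) 1,
      resolventMoment φ 0 s * (1 - genFun f s) = 2 * Real.pi := by
    intro s hs
    rw [hR0 s hs, mul_assoc, genFun_mul_one_sub_of_renewal hf1 hu1 hu0 hf0 hren hs, mul_one]
  have hne : ∀ s ∈ Metric.ball (0 : ℂ) 1, resolventMoment φ 0 s ≠ 0 := by
    intro s hs h0
    have := hprod s hs
    rw [h0, zero_mul] at this
    exact hpi this.symm
  have hF : ∀ s ∈ Metric.ball (0 : ℂ) 1,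
      genFun f s = 1 - 2 * Real.pi * (resolventMoment φ 0 s)⁻¹ := by
    intro s hs
    have h1 := hprod s hs
    have h2 := hne s hs
    field_simp
    linear_combination -h1
  -- No lower bound for `R₀` itself is needed: `1/R₀ = (1 - F)/(2π)`, and `‖F‖ ≤ 1` because the `f
  -- n` have total mass at most one.
  have hinv : ∀ s ∈ Metric.ball (0 : ℂ) 1, ‖(resolventMoment φ 0 s)⁻¹‖ ≤ 1 := by
    intro s hs
    have h1 : (resolventMoment φ 0 s)⁻¹ = (1 - genFun f s) / (2 * Real.pi) := by
      rw [← hprod s hs]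
      have h2 := hne s hs
      have h3 : 1 - genFun f s ≠ 0 := by
        intro h0
        have := hprod s hs
        rw [h0, mul_zero] at this
        exact hpi this.symm
      field_simp
    rw [h1, norm_div]
    have h4 : ‖(2 * Real.pi : ℂ)‖ = 2 * Real.pi := by
      rw [norm_mul, Complex.norm_real, Real.norm_of_nonneg Real.pi_pos.le]; simp
    rw [h4, div_le_one (by positivity)]
    have h5 := (norm_sub_le 1 (genFun f s)).trans
      (add_le_add le_rfl (norm_genFun_le_one hf hsum hs))
    rw [norm_one] at h5
    linarith [Real.pi_gt_three]
  have hopen : ∀ s ∈ Metric.ball (0 : ℂ) 1, Metric.ball (0 : ℂ) 1 ∈ 𝓝 s := fun s hs =>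
    Metric.isOpen_ball.mem_nhds hs
  have hd1 : ∀ s ∈ Metric.ball (0 : ℂ) 1, deriv (genFun f) s =
      2 * Real.pi * (resolventMoment φ 1 s / resolventMoment φ 0 s ^ 2) := by
    intro s hs
    have h1 : genFun f =ᶠ[𝓝 s] fun s => 1 - 2 * Real.pi * (resolventMoment φ 0 s)⁻¹ := by
      filter_upwards [hopen s hs] with z hz using hF z hz
    rw [h1.deriv_eq]
    have h2 := (((h.hasDerivAt_resolventMoment hs 0).fun_inv (hne s hs)).const_mul
      (2 * Real.pi : ℂ)).const_sub 1
    rw [h2.deriv]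
    simp
    ring
  have hd2 : ∀ s ∈ Metric.ball (0 : ℂ) 1, deriv (deriv (genFun f)) s = 2 * Real.pi *
      (2 * resolventMoment φ 2 s / resolventMoment φ 0 s ^ 2 -
        2 * resolventMoment φ 1 s ^ 2 / resolventMoment φ 0 s ^ 3) := by
    intro s hs
    have h1 : deriv (genFun f) =ᶠ[𝓝 s]
        fun s => 2 * Real.pi * (resolventMoment φ 1 s / resolventMoment φ 0 s ^ 2) := by
      filter_upwards [hopen s hs] with z hz using hd1 z hz
    rw [h1.deriv_eq]
    have h2 := ((h.hasDerivAt_resolventMoment hs 1).fun_div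
      ((h.hasDerivAt_resolventMoment hs 0).fun_pow 2) (pow_ne_zero 2 (hne s hs))).const_mul
      (2 * Real.pi : ℂ)
    rw [h2.deriv]
    have := hne s hs
    push_cast
    simp only [zero_add, one_mul, pow_one]
    field_simp
    ring
  have hdiff : DifferentiableOn ℂ (deriv (deriv (genFun f))) (Metric.ball 0 1) := by
    have h1 : DifferentiableOn ℂ (genFun f) (Metric.ball 0 1) := by
      have h2 := (hasFPowerSeriesOnBall_genFun hf1).differentiableOn
      rwa [← ENNReal.ofReal_one, Metric.eball_ofReal] at h2
    exact (h1.deriv Metric.isOpen_ball).deriv Metric.isOpen_ball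
  have hlim : Tendsto (fun s : ℂ => (1 - s) ^ ((1 / α + 1 : ℝ) : ℂ) * deriv (deriv (genFun f)) s)
      (𝓝[Metric.ball 0 1] 1)
      (𝓝 (2 * Real.pi * (((1 / α * (1 - 1 / α) : ℝ) : ℂ) / stableMoment α a 0))) := by
    refine ((h.tendsto_scaled_secondDeriv hm).const_mul (2 * Real.pi : ℂ)).congr' ?_
    filter_upwards [self_mem_nhdsWithin] with s hs
    rw [hd2 s hs]
    ring
  have hbd : ∀ δ > 0, ∃ K, ∀ s ∈ Metric.ball (0 : ℂ) 1, δ ≤ ‖1 - s‖ →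
      ‖deriv (deriv (genFun f)) s‖ ≤ K := by
    intro δ hδ
    obtain ⟨K₁, hK₁⟩ := h.norm_resolventMoment_le 1 hδ
    obtain ⟨K₂, hK₂⟩ := h.norm_resolventMoment_le 2 hδ
    refine ⟨2 * Real.pi * (2 * K₂ + 2 * K₁ ^ 2), fun s hs hsδ => ?_⟩
    rw [hd2 s hs, norm_mul]
    have h4 : ‖(2 * Real.pi : ℂ)‖ = 2 * Real.pi := by
      rw [norm_mul, Complex.norm_real, Real.norm_of_nonneg Real.pi_pos.le]; simp
    rw [h4]
    refine mul_le_mul_of_nonneg_left ?_ (by positivity)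
    have h5 := hinv s hs
    have h6 := hK₁ s hs hsδ
    have h7 := hK₂ s hs hsδ
    have h8 : ‖(resolventMoment φ 0 s)⁻¹‖ ^ 2 ≤ 1 := pow_le_one₀ (norm_nonneg _) h5
    have h9 : ‖(resolventMoment φ 0 s)⁻¹‖ ^ 3 ≤ 1 := pow_le_one₀ (norm_nonneg _) h5
    refine (norm_sub_le _ _).trans (add_le_add ?_ ?_)
    · rw [div_eq_mul_inv, ← inv_pow, norm_mul, norm_mul, norm_pow, Complex.norm_ofNat]
      calc _ ≤ 2 * ‖resolventMoment φ 2 s‖ * 1 := by gcongr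
        _ ≤ _ := by linarith
    · rw [div_eq_mul_inv, ← inv_pow, norm_mul, norm_mul, norm_pow, norm_pow, Complex.norm_ofNat]
      calc _ ≤ 2 * ‖resolventMoment φ 1 s‖ ^ 2 * 1 := by gcongr
        _ ≤ _ := by rw [mul_one]; gcongr
  have hβ : 0 < 1 / α := by positivity
  -- The second derivative is the first to have a singularity of exponent greater than `1`.
  have key := tendsto_coeff_of_singularity (p := 1 / α + 1) (by linarith) hdiff hlim hbd
  rw [← hκ] at key
  refine tendsto_mul_rpow_of_shift ?_
  have key2 := (Complex.continuous_re.tendsto _).comp key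
  rw [Complex.ofReal_re] at key2
  refine key2.congr fun n => ?_
  have h1 : iteratedDeriv n (deriv (deriv (genFun f))) 0 = (n + 2).factorial * f (n + 2) := by
    rw [← iteratedDeriv_genFun hf1, iteratedDeriv_succ', iteratedDeriv_succ']
  have hfac : (n.factorial : ℂ) ≠ 0 := by exact_mod_cast n.factorial_ne_zero
  have h2 : ((n : ℂ)) ^ (((1 / α + 1 : ℝ) : ℂ) - 1) = (((n : ℝ) ^ (1 / α) : ℝ) : ℂ) := by
    rw [Complex.ofReal_cpow n.cast_nonneg]
    congr 1
    push_cast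
    ring
  simp only [Function.comp]
  rw [h1, h2, Nat.factorial_succ, Nat.factorial_succ]
  have h3 : ((((n + 1 + 1) * ((n + 1) * n.factorial) : ℕ) : ℂ) * (f (n + 2) : ℂ) /
      (n.factorial : ℂ) / (((n : ℝ) ^ (1 / α) : ℝ) : ℂ)) =
      ((f (n + 2) * ((n + 2) * (n + 1)) / (n : ℝ) ^ (1 / α) : ℝ) : ℂ) := by
    push_cast
    field_simp
    ring
  rw [h3, Complex.ofReal_re]

end IsStableSymbol

/-! ### First returns of a path -/

theorem integral_exp_int_mul (m : ℤ) :
    ∫ θ in Set.Ioc (-Real.pi) Real.pi, Complex.exp ((θ : ℂ) * ((m : ℝ) : ℂ) * Complex.I) =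
      if m = 0 then (2 * Real.pi : ℂ) else 0 := by
  rw [← intervalIntegral.integral_of_le (by linarith [Real.pi_pos])]
  split_ifs with h
  · subst h
    simp
    ring
  · have hc : ((m : ℝ) : ℂ) * Complex.I ≠ 0 := by simp [h]
    have h1 : ∀ θ : ℝ, (θ : ℂ) * ((m : ℝ) : ℂ) * Complex.I = ((m : ℝ) : ℂ) * Complex.I * θ :=
      fun θ => by ring
    simp_rw [h1]
    rw [integral_exp_mul_complex hc, div_eq_zero_iff]
    left
    have h2 : ((m : ℝ) : ℂ) * Complex.I * (Real.pi : ℂ) =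
        ((m : ℝ) : ℂ) * Complex.I * ((-Real.pi : ℝ) : ℂ) + m * (2 * Real.pi * Complex.I) := by
      push_cast; ring
    rw [h2, Complex.exp_add, Complex.exp_int_mul_two_pi_mul_I, mul_one, sub_self]

/-- The path with increments `z` returns to its starting point for the first time at time `k`. -/
def IsFirstReturn (k : ℕ) (z : ℕ → ℤ) : Prop :=
  1 ≤ k ∧ ∑ i ∈ Finset.range k, z i = 0 ∧ ∀ m, 1 ≤ m → m < k → ∑ i ∈ Finset.range m, z i ≠ 0

theorem isFirstReturn_congr {k : ℕ} {y z : ℕ → ℤ} (h : ∀ i < k, y i = z i) :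
    IsFirstReturn k y ↔ IsFirstReturn k z := by
  have h1 : ∀ m ≤ k, ∑ i ∈ Finset.range m, y i = ∑ i ∈ Finset.range m, z i := fun m hm =>
    Finset.sum_congr rfl fun i hi => h i ((Finset.mem_range.1 hi).trans_le hm)
  unfold IsFirstReturn
  rw [h1 k le_rfl]
  refine and_congr_right fun _ => and_congr_right fun _ => forall_congr' fun m =>
    forall_congr' fun _ => forall_congr' fun hm => ?_
  rw [h1 m hm.le]

theorem entranceTime_eq_iff {Ω : Type*} (X : ℕ → Ω → ℤ) (ω : Ω) (n : ℕ) :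
    entranceTime X 0 {0} ω = (n : ℕ∞) ↔ IsFirstReturn n fun i => X i ω := by
  have hw : ∀ m, walk X 0 m ω = ∑ i ∈ Finset.range m, X i ω := fun m => by simp [walk]
  have hmem : ∀ m, walk X 0 m ω ∈ ({0} : Set ℤ) ↔ ∑ i ∈ Finset.range m, X i ω = 0 := fun m => by
    rw [Set.mem_singleton_iff, hw]
  have hle : ∀ m, 1 ≤ m → ∑ i ∈ Finset.range m, X i ω = 0 → entranceTime X 0 {0} ω ≤ m :=
    fun m h1 h2 => iInf₂_le m ⟨h1, (hmem m).2 h2⟩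
  constructor
  · intro h
    have hex : ∃ m : ℕ, (1 ≤ m ∧ walk X 0 m ω ∈ ({0} : Set ℤ)) ∧ m ≤ n := by
      by_contra! hcon
      have : ((n + 1 : ℕ) : ℕ∞) ≤ entranceTime X 0 {0} ω :=
        le_iInf₂ fun m hm => by exact_mod_cast hcon m hm
      rw [h] at this
      have : n + 1 ≤ n := by exact_mod_cast this
      omega
    obtain ⟨m, ⟨hm1, hm0⟩, hmn⟩ := hex
    have hnm : n ≤ m := by
      have := hle m hm1 ((hmem m).1 hm0)
      rw [h] at this
      exact_mod_cast this
    obtain rfl : m = n := le_antisymm hmn hnm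
    refine ⟨hm1, (hmem m).1 hm0, fun j hj1 hjm h0 => ?_⟩
    have := hle j hj1 h0
    rw [h] at this
    have : m ≤ j := by exact_mod_cast this
    omega
  · rintro ⟨h1, h2, h3⟩
    refine le_antisymm (hle n h1 h2) (le_iInf₂ fun m hm => ?_)
    by_contra! hlt
    exact h3 m hm.1 (by exact_mod_cast hlt) ((hmem m).1 hm.2)

/-- Extension of a finite path by zero increments. -/
def extendPath (k : ℕ) (y : Finset.range k → ℤ) (i : ℕ) : ℤ :=
  if h : i ∈ Finset.range k then y ⟨i, h⟩ else 0

/-- Exhibits the event as a function of the first `k` increments only. They take values in a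
countable discrete space, so measurability is automatic and independence of later increments
applies. -/
theorem setOf_isFirstReturn {Ω : Type*} (X : ℕ → Ω → ℤ) (k : ℕ) :
    {ω | IsFirstReturn k fun i => X i ω} =
      (fun ω (i : Finset.range k) => X i ω) ⁻¹' {y | IsFirstReturn k (extendPath k y)} := by
  ext ω
  simp only [Set.mem_ofPred_eq, Set.mem_preimage]
  refine isFirstReturn_congr fun i hi => ?_
  simp [extendPath, hi]

theorem isFirstReturn_unique {j k : ℕ} {z : ℕ → ℤ} (hj : IsFirstReturn j z)
    (hk : IsFirstReturn k z) : j = k := by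
  rcases lt_trichotomy j k with h | h | h
  · exact absurd hj.2.1 (hk.2.2 j hj.1 h)
  · exact h
  · exact absurd hk.2.1 (hj.2.2 k hk.1 h)

theorem exists_isFirstReturn {n : ℕ} {z : ℕ → ℤ} (hn : n ≠ 0)
    (h : ∑ i ∈ Finset.range n, z i = 0) : ∃ k ≤ n, IsFirstReturn k z := by
  classical
  have hex : ∃ m, 1 ≤ m ∧ ∑ i ∈ Finset.range m, z i = 0 := ⟨n, by omega, h⟩
  refine ⟨Nat.find hex, Nat.find_min' hex ⟨by omega, h⟩, (Nat.find_spec hex).1,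
    (Nat.find_spec hex).2, fun m hm1 hm h0 => Nat.find_min hex hm ⟨hm1, h0⟩⟩

/-! ### Characteristic functions and the renewal equation of the walk -/

section

variable {Ω : Type*} [MeasurableSpace Ω] {μ : Measure Ω}

theorem intCharFun_eq_integral {Y : Ω → ℤ} (hY : Measurable Y) (θ : ℝ) :
    intCharFun μ Y θ = ∫ ω, Complex.exp ((θ : ℂ) * ((Y ω : ℝ) : ℂ) * Complex.I) ∂μ := by
  have hY' : Measurable fun ω => (Y ω : ℝ) := measurable_from_top.comp hY
  rw [intCharFun, charFun_apply_real, integral_map hY'.aemeasurable]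
  exact Measurable.aestronglyMeasurable (by fun_prop)

/-- Fourier inversion at the origin for an integer-valued random variable. -/
theorem integral_intCharFun [IsProbabilityMeasure μ] {Y : Ω → ℤ} (hY : Measurable Y) :
    ∫ θ in Set.Ioc (-Real.pi) Real.pi, intCharFun μ Y θ =
      2 * Real.pi * (μ.real {ω | Y ω = 0} : ℂ) := by
  have hY' : Measurable fun ω => (Y ω : ℝ) := measurable_from_top.comp hY
  simp_rw [intCharFun_eq_integral hY]
  rw [integral_integral_swap]
  · simp_rw [integral_exp_int_mul]
    have h1 : (fun ω => if Y ω = 0 then (2 * Real.pi : ℂ) else 0) =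
        {ω | Y ω = 0}.indicator fun _ => (2 * Real.pi : ℂ) := by
      ext ω
      simp [Set.indicator_apply]
    have hms : MeasurableSet {ω | Y ω = 0} := hY (measurableSet_singleton 0)
    rw [h1, integral_indicator_const _ hms, Complex.real_smul, mul_comm]
  · refine Integrable.of_bound (C := 1) (Measurable.aestronglyMeasurable ?_)
      (Eventually.of_forall fun p => ?_)
    · simp only [Function.uncurry_def]
      fun_prop
    · simp only [Function.uncurry]
      rw [← Complex.ofReal_mul, Complex.norm_exp_ofReal_mul_I]

theorem IsIIDIncrements.measurable_sum {X : ℕ → Ω → ℤ} (hX : IsIIDIncrements μ X)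
    (s : Finset ℕ) : Measurable fun ω => ∑ i ∈ s, X i ω :=
  Finset.measurable_fun_sum s fun i _ => hX.measurable i

theorem IsIIDIncrements.intCharFun_sum {X : ℕ → Ω → ℤ} (hX : IsIIDIncrements μ X)
    (s : Finset ℕ) (θ : ℝ) :
    intCharFun μ (fun ω => ∑ i ∈ s, X i ω) θ = intCharFun μ (X 0) θ ^ s.card := by
  have hm : ∀ i, Measurable fun ω => (X i ω : ℝ) := fun i =>
    measurable_from_top.comp (hX.measurable i)
  have hind : iIndepFun (fun i ω => (X i ω : ℝ)) μ :=
    hX.indep.comp (fun _ z => (z : ℝ)) fun _ => measurable_from_top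
  have hid : ∀ i, μ.map (fun ω => (X i ω : ℝ)) = μ.map (fun ω => (X 0 ω : ℝ)) := fun i =>
    ((hX.identDistrib i).comp (u := fun z : ℤ => (z : ℝ)) measurable_from_top).map_eq
  have h1 := (hind.restrict s).charFun_map_fun_finsetSum_eq_prod
    (fun i _ => (hm i).aemeasurable)
  have h2 := congrFun h1 θ
  unfold intCharFun
  push_cast
  rw [h2, Finset.prod_apply]
  simp_rw [hid]
  rw [Finset.prod_const]

theorem IsIIDIncrements.integral_intCharFun_pow [IsProbabilityMeasure μ] {X : ℕ → Ω → ℤ}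
    (hX : IsIIDIncrements μ X)
    (s : Finset ℕ) :
    ∫ θ in Set.Ioc (-Real.pi) Real.pi, intCharFun μ (X 0) θ ^ s.card =
      2 * Real.pi * (μ.real {ω | ∑ i ∈ s, X i ω = 0} : ℂ) := by
  simp_rw [← hX.intCharFun_sum s]
  exact integral_intCharFun (hX.measurable_sum s)

/-- The law of a sum of increments depends only on the number of summands. -/
theorem IsIIDIncrements.measureReal_sum_eq_zero [IsProbabilityMeasure μ] {X : ℕ → Ω → ℤ}
    (hX : IsIIDIncrements μ X)
    {s t : Finset ℕ} (hst : s.card = t.card) :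
    μ.real {ω | ∑ i ∈ s, X i ω = 0} = μ.real {ω | ∑ i ∈ t, X i ω = 0} := by
  -- Both probabilities are given by the same Fourier integral, that of `φ` to the power of the
  -- common cardinality.
  have h1 := hX.integral_intCharFun_pow s
  rw [hst, hX.integral_intCharFun_pow t] at h1
  have hpi : (2 * Real.pi : ℂ) ≠ 0 := by
    exact_mod_cast (by positivity : (2 * Real.pi : ℝ) ≠ 0)
  exact_mod_cast (mul_left_cancel₀ hpi h1).symm

theorem firstHitProb_eq (X : ℕ → Ω → ℤ) (n : ℕ) :
    firstHitProb μ X 0 n = μ.real {ω | IsFirstReturn n fun i => X i ω} := by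
  simp only [firstHitProb, entranceTime_eq_iff]

theorem IsIIDIncrements.measurableSet_isFirstReturn {X : ℕ → Ω → ℤ} (hX : IsIIDIncrements μ X)
    (k : ℕ) : MeasurableSet {ω | IsFirstReturn k fun i => X i ω} := by
  rw [setOf_isFirstReturn]
  exact (measurable_pi_lambda (fun ω (i : Finset.range k) => X i ω) fun i => hX.measurable i)
    MeasurableSet.of_discrete

/-- After a first return at time `k`, being at `0` at time `n` means that the increments from `k` to
`n` sum to zero. These are independent of the first `k`, and their sum vanishes with the same
probability as that of the first `n - k` increments. -/
theorem IsIIDIncrements.measureReal_firstReturn_inter [IsProbabilityMeasure μ] {X : ℕ → Ω → ℤ}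
    (hX : IsIIDIncrements μ X) {k n : ℕ} (hkn : k ≤ n) :
    μ.real ({ω | IsFirstReturn k fun i => X i ω} ∩ {ω | ∑ i ∈ Finset.range n, X i ω = 0}) =
      μ.real {ω | IsFirstReturn k fun i => X i ω} *
        μ.real {ω | ∑ i ∈ Finset.range (n - k), X i ω = 0} := by
  have h1 : {ω | IsFirstReturn k fun i => X i ω} ∩ {ω | ∑ i ∈ Finset.range n, X i ω = 0} =
      {ω | IsFirstReturn k fun i => X i ω} ∩ {ω | ∑ i ∈ Finset.Ico k n, X i ω = 0} := by
    ext ω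
    simp only [Set.mem_inter_iff, Set.mem_ofPred_eq]
    refine and_congr_right fun h => ?_
    rw [← Finset.sum_range_add_sum_Ico _ hkn, h.2.1, zero_add]
  have h2 : {ω | ∑ i ∈ Finset.Ico k n, X i ω = 0} =
      (fun ω (i : Finset.Ico k n) => X i ω) ⁻¹' {y | ∑ i, y i = 0} := by
    ext ω
    simp only [Set.mem_ofPred_eq, Set.mem_preimage]
    rw [← Finset.sum_coe_sort]
  have hdisj : Disjoint (Finset.range k) (Finset.Ico k n) := by
    rw [Finset.disjoint_left]
    intro i hi hi'
    rw [Finset.mem_range] at hi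
    rw [Finset.mem_Ico] at hi'
    omega
  have hind := hX.indep.indepFun_finset (Finset.range k) (Finset.Ico k n) hdisj hX.measurable
  rw [h1, ← hX.measureReal_sum_eq_zero (s := Finset.Ico k n) (t := Finset.range (n - k))
    (by simp), h2, setOf_isFirstReturn, measureReal_def,
    hind.measure_inter_preimage_eq_mul _ _ MeasurableSet.of_discrete MeasurableSet.of_discrete,
    ENNReal.toReal_mul]
  rfl

/-- The renewal equation for the return probabilities. -/
theorem IsIIDIncrements.renewal [IsProbabilityMeasure μ] {X : ℕ → Ω → ℤ}
    (hX : IsIIDIncrements μ X) {n : ℕ} (hn : n ≠ 0) :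
    μ.real {ω | ∑ i ∈ Finset.range n, X i ω = 0} =
      ∑ p ∈ Finset.HasAntidiagonal.antidiagonal n, firstHitProb μ X 0 p.1 *
        μ.real {ω | ∑ i ∈ Finset.range p.2, X i ω = 0} := by
  have h1 : {ω | ∑ i ∈ Finset.range n, X i ω = 0} = ⋃ k ∈ Finset.range (n + 1),
      ({ω | IsFirstReturn k fun i => X i ω} ∩ {ω | ∑ i ∈ Finset.range n, X i ω = 0}) := by
    ext ω
    simp only [Set.mem_ofPred_eq, Set.mem_iUnion, Set.mem_inter_iff, Finset.mem_range, exists_prop]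
    constructor
    · intro h
      obtain ⟨k, hk, hk'⟩ := exists_isFirstReturn hn h
      exact ⟨k, by omega, hk', h⟩
    · rintro ⟨k, _, _, h⟩
      exact h
  rw [Finset.Nat.sum_antidiagonal_eq_sum_range_succ_mk, h1, measureReal_biUnion_finset]
  · refine Finset.sum_congr rfl fun k hk => ?_
    rw [hX.measureReal_firstReturn_inter (by rw [Finset.mem_range] at hk; omega),
      firstHitProb_eq]
  · intro j _ k _ hjk
    refine Set.disjoint_left.2 fun ω h1 h2 => hjk ?_
    exact isFirstReturn_unique h1.1 h2.1
  · intro k _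
    exact (hX.measurableSet_isFirstReturn k).inter
      (hX.measurable_sum _ (measurableSet_singleton 0))

theorem IsIIDIncrements.sum_firstHitProb_le_one [IsProbabilityMeasure μ] {X : ℕ → Ω → ℤ}
    (hX : IsIIDIncrements μ X)
    (n : ℕ) : ∑ k ∈ Finset.range n, firstHitProb μ X 0 k ≤ 1 := by
  simp_rw [firstHitProb_eq]
  rw [← measureReal_biUnion_finset]
  · exact measureReal_le_one
  · intro j _ k _ hjk
    exact Set.disjoint_left.2 fun ω h1 h2 => hjk (isFirstReturn_unique h1 h2)
  · exact fun k _ => hX.measurableSet_isFirstReturn k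

theorem firstHitProb_zero (X : ℕ → Ω → ℤ) : firstHitProb μ X 0 0 = 0 := by
  rw [firstHitProb_eq]
  simp [IsFirstReturn]

theorem norm_intCharFun_le_one [IsProbabilityMeasure μ] {Y : Ω → ℤ} (hY : Measurable Y) (θ : ℝ) :
    ‖intCharFun μ Y θ‖ ≤ 1 := by
  have hY' : Measurable fun ω => (Y ω : ℝ) := measurable_from_top.comp hY
  have := Measure.isProbabilityMeasure_map (μ := μ) hY'.aemeasurable
  exact norm_charFun_le_one θ

/-- If an integer-valued variable charges both `0` and `1`, its characteristic function has modulus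
less than one off the multiples of `2π`. -/
theorem norm_intCharFun_lt_one [IsProbabilityMeasure μ] {Y : Ω → ℤ} (hY : Measurable Y)
    (h0 : 0 < μ.real {ω | Y ω = 0})
    (h1 : 0 < μ.real {ω | Y ω = 1}) {θ : ℝ} (hθ : |θ| ≤ Real.pi) (hθ0 : θ ≠ 0) :
    ‖intCharFun μ Y θ‖ < 1 := by
  rw [intCharFun_eq_integral hY]
  have hb : ∀ᵐ ω ∂μ, ‖Complex.exp ((θ : ℂ) * ((Y ω : ℝ) : ℂ) * Complex.I)‖ ≤ 1 :=
    Eventually.of_forall fun ω => by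
      rw [← Complex.ofReal_mul, Complex.norm_exp_ofReal_mul_I]
  -- Equality case: if the mean of unimodular values had modulus one, they would be almost surely
  -- constant. Charging `0` and `1` then forces `exp(iθ) = 1`, impossible for `0 < |θ| ≤ π`.
  rcases ae_eq_const_or_norm_integral_lt_of_norm_le_const hb with h | h
  · exfalso
    set z := ⨍ ω, Complex.exp ((θ : ℂ) * ((Y ω : ℝ) : ℂ) * Complex.I) ∂μ
    have hval : ∀ j : ℤ, 0 < μ.real {ω | Y ω = j} →
        Complex.exp ((θ : ℂ) * ((j : ℝ) : ℂ) * Complex.I) = z := by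
      intro j hj
      by_contra hne
      have h2 : μ {ω | Y ω = j} = 0 := by
        refine measure_mono_null (fun ω hω => ?_) h
        have hω' : Y ω = j := hω
        simp only [Set.mem_compl_iff, Set.mem_ofPred_eq, hω', Function.const_apply]
        exact hne
      rw [measureReal_def, h2] at hj
      simp at hj
    have h2 := (hval 1 h1).trans (hval 0 h0).symm
    simp only [Int.cast_one, Int.cast_zero, Complex.ofReal_one, Complex.ofReal_zero, mul_one,
      mul_zero, zero_mul, Complex.exp_zero] at h2
    obtain ⟨n, hn⟩ := Complex.exp_eq_one_iff.1 h2
    have h3 : (θ : ℂ) = ((n * (2 * Real.pi) : ℝ) : ℂ) := by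
      have hI : ((θ : ℂ) - n * (2 * Real.pi)) * Complex.I = 0 := by linear_combination hn
      have := (mul_eq_zero.1 hI).resolve_right Complex.I_ne_zero
      push_cast
      linear_combination this
    have h4 : θ = n * (2 * Real.pi) := by exact_mod_cast h3
    have hn0 : n ≠ 0 := by
      rintro rfl
      simp at h4
      exact hθ0 h4
    have h5 : (1 : ℝ) ≤ |(n : ℝ)| := by exact_mod_cast Int.one_le_abs hn0
    rw [h4, abs_mul, abs_of_pos (by positivity : (0 : ℝ) < 2 * Real.pi)] at hθ
    nlinarith [Real.pi_pos]
  · simpa using h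

/-- A single increment need not charge `0` and `1`, but `S_n` does for some `n`; its characteristic
function is `φ^n`, and `|φ|^n < 1` forces `|φ| < 1`. -/
theorem norm_intCharFun_lt_one_of_isStronglyAperiodic [IsProbabilityMeasure μ] {X : ℕ → Ω → ℤ}
    (hX : IsIIDIncrements μ X)
    (haper : IsStronglyAperiodic μ X) {θ : ℝ} (hθ : |θ| ≤ Real.pi) (hθ0 : θ ≠ 0) :
    ‖intCharFun μ (X 0) θ‖ < 1 := by
  obtain ⟨n, h0, h1⟩ := ((haper 0).and (haper 1)).exists
  simp only [walk, zero_add] at h0 h1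
  have h2 := norm_intCharFun_lt_one (hX.measurable_sum (Finset.range n)) h0 h1 hθ hθ0
  rw [hX.intCharFun_sum, norm_pow] at h2
  by_contra! h3
  exact absurd (one_le_pow₀ h3) (not_le.2 h2)

theorem intCharFun_zero [IsProbabilityMeasure μ] (Y : Ω → ℤ) (hY : Measurable Y) :
    intCharFun μ Y 0 = 1 := by
  rw [intCharFun_eq_integral hY]
  simp

theorem continuous_intCharFun [IsProbabilityMeasure μ] {Y : Ω → ℤ} (hY : Measurable Y) :
    Continuous (intCharFun μ Y) := by
  have hY' : Measurable fun ω => (Y ω : ℝ) := measurable_from_top.comp hY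
  have := Measure.isProbabilityMeasure_map (μ := μ) hY'.aemeasurable
  exact continuous_charFun

end

/-! ### Identification of the constant -/

/-- Since `α > 1`, the condition on `γ` gives `|γ| < 1`. This puts the coefficient `c exp(iπγ/2)` in
the open right half-plane. -/
theorem abs_pi_mul_div_two_lt {α γ : ℝ} (hα : 1 < α) (hγ : |γ| ≤ 2 - α) :
    |Real.pi * γ / 2| < Real.pi / 2 := by
  rw [abs_div, abs_mul, abs_of_pos Real.pi_pos, abs_two]
  have : |γ| < 1 := by linarith
  have := mul_lt_mul_of_pos_left this Real.pi_pos
  linarith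

theorem re_mul_exp (c ψ : ℝ) : ((c : ℂ) * Complex.exp (ψ * Complex.I)).re = c * Real.cos ψ := by
  rw [Complex.re_ofReal_mul, Complex.exp_ofReal_mul_I_re]

theorem conj_mul_exp (c ψ : ℝ) : starRingEnd ℂ ((c : ℂ) * Complex.exp (ψ * Complex.I)) =
    (c : ℂ) * Complex.exp (((-ψ : ℝ) : ℂ) * Complex.I) := by
  rw [map_mul, ← Complex.exp_conj]
  simp

/-- The bound on `ψ` keeps the argument within the principal branch of the logarithm. -/
theorem mul_exp_cpow {c : ℝ} (hc : 0 < c) {ψ : ℝ} (hψ : |ψ| < Real.pi) (s : ℝ) :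
    ((c : ℂ) * Complex.exp (ψ * Complex.I)) ^ (s : ℂ) =
      ((c ^ s : ℝ) : ℂ) * Complex.exp (((s * ψ : ℝ) : ℂ) * Complex.I) := by
  have h := abs_lt.1 hψ
  have hc0 : (c : ℂ) ≠ 0 := by exact_mod_cast hc.ne'
  rw [Complex.cpow_def_of_ne_zero (mul_ne_zero hc0 (Complex.exp_ne_zero _)),
    Complex.log_ofReal_mul hc (Complex.exp_ne_zero _),
    Complex.log_exp (by simpa using h.1) (by simpa using h.2.le), add_mul, Complex.exp_add,
    Complex.ofReal_cpow hc.le, Complex.cpow_def_of_ne_zero hc0, Complex.ofReal_log hc.le]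
  congr 2
  push_cast
  ring

/-- The two half-lines contribute conjugate powers, whose sum is twice a cosine. -/
theorem stableMoment_zero_eq {α c ψ : ℝ} (hc : 0 < c) (hψ : |ψ| < Real.pi) :
    stableMoment α ((c : ℂ) * Complex.exp (ψ * Complex.I)) 0 =
      ((Real.Gamma (1 / α + 1) * Real.Gamma (1 - 1 / α) *
        (2 * c ^ (-(1 / α)) * Real.cos (1 / α * ψ)) : ℝ) : ℂ) := by
  unfold stableMoment
  rw [conj_mul_exp, ← Complex.ofReal_neg, mul_exp_cpow hc hψ, mul_exp_cpow hc (by rwa [abs_neg]),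
    Complex.Gamma_ofReal, Complex.Gamma_ofReal]
  push_cast
  rw [Complex.cos]
  rw [show -(1 / (α : ℂ)) * (ψ : ℂ) * Complex.I = -(1 / (α : ℂ) * ψ) * Complex.I by ring,
    show -(1 / (α : ℂ)) * -(ψ : ℂ) * Complex.I = 1 / (α : ℂ) * ψ * Complex.I by ring]
  simp only [Nat.factorial_zero, Nat.cast_one, inv_one, zero_add, one_mul,
    neg_mul]
  ring

theorem cos_stable_pos {α γ : ℝ} (hα : 1 < α) (hγ : |γ| ≤ 2 - α) :
    0 < Real.cos (1 / α * (Real.pi * γ / 2)) := by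
  have h1 := abs_pi_mul_div_two_lt hα hγ
  have h2 : |1 / α * (Real.pi * γ / 2)| ≤ |Real.pi * γ / 2| := by
    rw [abs_mul, abs_of_pos (by positivity)]
    have : 1 / α ≤ 1 := by rw [div_le_one (by linarith)]; exact hα.le
    nlinarith [abs_nonneg (Real.pi * γ / 2)]
  have h3 := abs_lt.1 (h2.trans_lt h1)
  exact Real.cos_pos_of_mem_Ioo ⟨by linarith [h3.1], h3.2⟩

theorem sin_stable_eq_cos {α γ : ℝ} (hα : 0 < α) :
    Real.sin (Real.pi * (α - γ) / (2 * α)) = Real.cos (1 / α * (Real.pi * γ / 2)) := by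
  rw [← Real.sin_pi_div_two_sub]
  congr 1
  field_simp

theorem returnConst_pos {α γ : ℝ} (hα : 1 < α) (hγ : |γ| ≤ 2 - α) : 0 < returnConst α γ := by
  have hα0 : 0 < α := by linarith
  have h1 := sin_stable_eq_cos (γ := γ) hα0
  have h2 : 0 < Real.sin (Real.pi / α) :=
    Real.sin_pos_of_pos_of_lt_pi (by positivity) (div_lt_self Real.pi_pos hα)
  have h3 := cos_stable_pos hα hγ
  have h4 : 0 < Real.Gamma (1 / α) := Real.Gamma_pos_of_pos (by positivity)
  rw [returnConst, h1]
  have : 0 < α - 1 := by linarith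
  positivity

/-- Reflection replaces `Γ(1 - 1/α)` by `π / (sin(π/α) Γ(1/α))`, and `Γ(1/α + 1) = Γ(1/α)/α` turns
the remaining factors into `(α - 1)/Γ(1/α)`. -/
theorem returnConst_eq {α γ c : ℝ} (hα : 1 < α) (hγ : |γ| ≤ 2 - α) (hc : 0 < c) :
    returnConst α γ * c ^ (1 / α) = 2 * Real.pi * (1 / α * (1 - 1 / α) /
      (Real.Gamma (1 / α + 1) * Real.Gamma (1 - 1 / α) *
        (2 * c ^ (-(1 / α)) * Real.cos (1 / α * (Real.pi * γ / 2))))) *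
      (Real.Gamma (1 / α + 1))⁻¹ := by
  have hα0 : 0 < α := by linarith
  have h1 := sin_stable_eq_cos (γ := γ) hα0
  have h2 : 0 < Real.sin (Real.pi / α) :=
    Real.sin_pos_of_pos_of_lt_pi (by positivity) (div_lt_self Real.pi_pos hα)
  have h3 := cos_stable_pos hα hγ
  have hβ : 0 < 1 / α := by positivity
  have h4 : 0 < Real.Gamma (1 / α) := Real.Gamma_pos_of_pos hβ
  have h5 : Real.Gamma (1 - 1 / α) = Real.pi / (Real.sin (Real.pi / α) * Real.Gamma (1 / α)) := by
    have := Real.Gamma_mul_Gamma_one_sub (1 / α)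
    rw [mul_one_div] at this
    field_simp at this ⊢
    linarith
  have h6 := Real.Gamma_add_one hβ.ne'
  rw [returnConst, h1, h6, h5, Real.rpow_neg hc.le]
  have h7 : 0 < c ^ (1 / α) := by positivity
  generalize Real.cos (1 / α * (Real.pi * γ / 2)) = C at *
  generalize Real.Gamma (1 / α) = G at *
  generalize c ^ (1 / α) = P at *
  generalize Real.sin (Real.pi / α) = S at *
  have hpi := Real.pi_pos
  field_simp

theorem theorem1 {Ω : Type*} [MeasurableSpace Ω] (μ : Measure Ω) [IsProbabilityMeasure μ]
    (X : ℕ → Ω → ℤ) (hX : IsIIDIncrements μ X)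
    (α γ c : ℝ) (hα : 1 < α) (hα' : α < 2) (hc : 0 < c) (hγ : |γ| ≤ 2 - α)
    (hattr : InDomainOfNormalAttraction μ (X 0) α γ c)
    (haper : IsStronglyAperiodic μ X) :
    (fun n : ℕ => firstHitProb μ X 0 n) ~[atTop]
      (fun n : ℕ => returnConst α γ * c ^ (1 / α) / (n : ℝ) ^ (2 - 1 / α)) := by
  have hψ := abs_pi_mul_div_two_lt hα hγ
  have hψ' : |Real.pi * γ / 2| < Real.pi := by linarith [Real.pi_pos]
  have hcos : 0 < Real.cos (Real.pi * γ / 2) := by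
    have := abs_lt.1 hψ
    exact Real.cos_pos_of_mem_Ioo ⟨by linarith [this.1], this.2⟩
  have hsymb : IsStableSymbol (intCharFun μ (X 0)) α
      ((c : ℂ) * Complex.exp (((Real.pi * γ / 2 : ℝ) : ℂ) * Complex.I)) :=
    { continuous := continuous_intCharFun (hX.measurable 0)
      norm_le_one := norm_intCharFun_le_one (hX.measurable 0)
      norm_lt_one := fun θ h h' => norm_intCharFun_lt_one_of_isStronglyAperiodic hX haper h h'
      map_zero := intCharFun_zero _ (hX.measurable 0)
      one_lt := hα
      re_pos := by rw [re_mul_exp]; positivity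
      right := by
        convert hattr.right using 4
        push_cast
        ring
      left := by
        rw [conj_mul_exp]
        convert hattr.left using 4
        push_cast
        ring }
  have hm := stableMoment_zero_eq (α := α) hc hψ'
  have hβ : 1 / α < 1 := by rw [div_lt_one (by linarith)]; exact hα
  have hm0 : Real.Gamma (1 / α + 1) * Real.Gamma (1 - 1 / α) *
      (2 * c ^ (-(1 / α)) * Real.cos (1 / α * (Real.pi * γ / 2))) ≠ 0 := by
    have h1 := cos_stable_pos hα hγ
    have h2 : 0 < Real.Gamma (1 / α + 1) := Real.Gamma_pos_of_pos (by positivity)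
    have h3 : 0 < Real.Gamma (1 - 1 / α) := Real.Gamma_pos_of_pos (by linarith)
    positivity
  have hlim := hsymb.tendsto_renewal (by rw [hm]; exact_mod_cast hm0)
    (f := firstHitProb μ X 0) (u := fun n => μ.real {ω | ∑ i ∈ Finset.range n, X i ω = 0})
    (fun n => measureReal_nonneg) hX.sum_firstHitProb_le_one (firstHitProb_zero X) (by simp)
    (fun n => by rw [abs_of_nonneg measureReal_nonneg]; exact measureReal_le_one)
    (fun n hn => hX.renewal hn)
    (fun n => by
      have := hX.integral_intCharFun_pow (Finset.range n)
      rwa [Finset.card_range] at this)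
    (κ := returnConst α γ * c ^ (1 / α))
    (by
      rw [hm, returnConst_eq hα hγ hc, Complex.Gamma_ofReal]
      push_cast
      ring)
  have hκ : 0 < returnConst α γ * c ^ (1 / α) := mul_pos (returnConst_pos hα hγ) (by positivity)
  refine isEquivalent_of_tendsto_one ?_
  have h1 := hlim.div_const (returnConst α γ * c ^ (1 / α))
  rw [div_self hκ.ne'] at h1
  refine h1.congr fun n => ?_
  rw [Pi.div_apply, div_div_eq_mul_div]
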